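/- Let $F/\mathbb{F}_q$ be an algebraic function field of one variable with full constant field $\mathbb{F}_q$, and let $r_1,r_2\ge 1$ be integers. For $i=1,2$ let $H_i$ be a subgroup of $\mathrm{Aut}(F/\mathbb{F}_q)$ of order $r_i+1$ with fixed field $F_i=F^{H_i}$, and suppose that $G=H_1\rtimes H_2$ (internal semidirect product, $H_1$ normal) is a subgroup of $\mathrm{Aut}(F/\mathbb{F}_q)$; put $E=F^G$. Let $Q_1,\dots,Q_s$ be distinct rational places of $E$ that split completely in $F/E$, and let $\mathcal{P}=\{P_1,\dots,P_n\}$ be the set of all places of $F$ lying over some $Q_j$ (with $P_1,\dots,P_n$ distinct). Suppose that $w_1,w_2\in F$ satisfy, for $i=1,2$: 1. $1,w_i,w_i^2,\dots,w_i^{r_i-1}$ are linearly independent over $F_i$; 2. for every $P\in\mathcal{P}$, $w_i$ takes pairwise distinct values (in $\mathbb{F}_q\cup\{\infty\}$) at the places of $\{\sigma(P):\sigma\in H_i\}$. Let $1\le d\le n$ be an integer and let $D$ be an effective divisor of $F$ of degree $n-d$ with $\mathrm{supp}(D)\cap\mathcal{P}=\emptyset$ and $(r_i-1)(w_i)_\infty\le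 D$ for $i=1,2$, where $(w_i)_\infty$ is the pole divisor of $w_i$. Let $D_i$ be the largest effective divisor of $F_i$ such that $(r_i-1)(w_i)_\infty+\mathrm{Conorm}_{F/F_i}(D_i)\le D$, let $f_{i,1},\dots,f_{i,m_i}$ be an $\mathbb{F}_q$-basis of the Riemann–Roch space $\mathcal{L}(D_i)$, and put $$V_i=\Big\{\sum_{l=0}^{r_i-1}\Big(\sum_{j=1}^{m_i}c_{i,j,l}f_{i,j}\Big)w_i^l : c_{i,j,l}\in\mathbb{F}_q\Big\}\quad(i=1,2),\qquad V=V_1\cap V_2,$$ and assume $V\ne 0$. Then $n=s(r_1+1)(r_2+1)$, the places $P_1,\dots,P_n$ are rational, $V_1,V_2\subseteq\mathcal{L}(D)$, every $f\in V$ is regular at all the $P_j$, and the image of $$ev_{\mathcal{P}}:V\to\mathbb{F}_q^n,\qquad f\mapsto(f(P_1),\dots,f(P_n)),$$ is a linear code of length $n$, dimension $\dim_{\mathbb{F}_q}V$ and minimum distance at least $d$ that is locally repairable with availability $2$ and locality $(r_1,r_2)$; that is, writing $C$ for this code, for every coordinate $i$ there are disjoint sets $I_{i,1},I_{i,2}\subseteq\{1,\dots,n\}\setminus\{i\}$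 with $|I_{i,j}|\le r_j$ such that for all $\alpha\ne\beta$ in $\mathbb{F}_q$ the projections to the coordinates $I_{i,j}$ of $\{c\in C:c_i=\alpha\}$ and of $\{c\in C:c_i=\beta\}$ are disjoint ($j=1,2$). -/

import Mathlib

open scoped WithZero

noncomputable section

namespace FunctionFieldCode

/-! ### Function fields of one variable, places, divisors -/

/-- `F / k` is an algebraic function field of one variable whose full constant field is `k`:
`F` is a finite extension of `k(x)` for some `x ∈ F` transcendental over `k`, and every element
of `F` algebraic over `k` lies in `k`. -/
structure IsFunctionField (k F : Type*) [Field k] [Field F] [Algebra k F] : Prop where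
  exists_finite : ∃ x : F, Transcendental k x ∧ FiniteDimensional (IntermediateField.adjoin k {x}) F
  fullConstants : algebraicClosure k F = ⊥

/-- A place of `F / k`, given by its valuation ring: a discrete valuation ring of the field `F`
that contains `k`. (In a function field of one variable every valuation ring of `F / k` other
than `F` itself is discrete; a discrete valuation ring is not a field, so `F` is excluded.) -/
@[ext]
structure Place (k F : Type*) [Field k] [Field F] [Algebra k F] where
  /-- the valuation ring of the place -/
  ring : ValuationSubring F
  const_mem : ∀ a : k, algebraMap k F a ∈ ring
  discrete : IsDiscreteValuationRing ring

namespace Place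

variable {k F : Type*} [Field k] [Field F] [Algebra k F]

instance (P : Place k F) : IsDiscreteValuationRing P.ring := P.discrete

instance (P : Place k F) : Algebra k P.ring :=
  ((algebraMap k F).codRestrict P.ring.toSubring P.const_mem).toAlgebra

/-- The degree `[O_P / P : k]` of a place. -/
def degree (P : Place k F) : ℕ := Module.finrank k (IsLocalRing.ResidueField P.ring)

/-- A rational place: a place of degree one. -/
def IsRational (P : Place k F) : Prop := P.degree = 1

/-- The normalized discrete valuation of `P` on `F`, written multiplicatively
(it is `exp (- ν_P z)` at `z ≠ 0`, and `0` at `0`). -/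
def val (P : Place k F) : Valuation F ℤᵐ⁰ :=
  (IsDiscreteValuationRing.maximalIdeal P.ring).valuation F

/-- The normalized discrete valuation `ν_P(z)`, for `z ≠ 0` (the value at `0` is irrelevant). -/
def ord (P : Place k F) (z : F) : ℤ := -WithZero.log (P.val z)

/-- The coefficient at `P` of the pole divisor `(z)_∞`. -/
def poleOrder (P : Place k F) (z : F) : ℤ := max 0 (-P.ord z)

/-- `z` is regular at `P` and its residue class at `P` is that of the constant `a`,
i.e. `z - a` lies in the maximal ideal of `P`. -/
def HasValue (P : Place k F) (z : F) (a : k) : Prop :=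
  P.ring.valuation (z - algebraMap k F a) < 1

open Classical in
/-- The value `z(P) ∈ k` of a function `z` regular at a rational place `P`
(`0` by convention if there is no such value). -/
def value (P : Place k F) (z : F) : k := if h : ∃ a, P.HasValue z a then h.choose else 0

open Classical in
/-- The value `z(P) ∈ k ∪ {∞}` of an arbitrary function at a rational place,
equal to `∞` exactly when `z` has a pole at `P`. -/
def extValue (P : Place k F) (z : F) : OnePoint k :=
  if z ∈ P.ring then ((P.value z : k) : OnePoint k) else OnePoint.infty

/-- For a subextension `K` of `F / k`, the place `P` of `F` lies over the place `Q` of `K`: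
`O_Q = O_P ∩ K`. -/
def LiesOver {K : IntermediateField k F} (P : Place k F) (Q : Place k K) : Prop :=
  Q.ring = P.ring.comap (algebraMap K F)

/-- The ramification index `e(P|Q)` of a place `P` lying over `Q`: the number `e` with
`ν_P = e ν_Q` on `K`. -/
def ramificationIndex {K : IntermediateField k F} (P : Place k F) (Q : Place k K) : ℕ :=
  sInf {e : ℕ | ∀ x : K, P.ord (x : F) = e * Q.ord x}

/-- The place `Q` of `K` splits completely in `F`: there are exactly `[F : K]` places of `F`
over it (and `[F : K]` is finite). -/
def SplitsCompletely {K : IntermediateField k F} (Q : Place k K) : Prop :=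
  FiniteDimensional K F ∧ {P : Place k F | P.LiesOver Q}.ncard = Module.finrank K F

/-- The orbit `{σ(P) : σ ∈ H}` of a place, where `σ(P) = {σ z : z ∈ P}`; on valuation rings,
`O_{σ(P)} = σ(O_P)`. -/
def orbit (H : Subgroup (F ≃ₐ[k] F)) (P : Place k F) : Set (Place k F) :=
  {P' | ∃ σ ∈ H, ∀ z : F, σ z ∈ P'.ring ↔ z ∈ P.ring}

end Place

variable {k F : Type*} [Field k] [Field F] [Algebra k F]

/-- Divisors: finite formal integral combinations of places, ordered coefficientwise. -/
abbrev Divisor (k F : Type*) [Field k] [Field F] [Algebra k F] := Place k F →₀ ℤ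

/-- The degree `∑ D(P) deg P` of a divisor. -/
def Divisor.degree (D : Divisor k F) : ℤ := D.sum fun P a => a * P.degree

open Classical in
/-- The coefficient at `P` of the conorm `∑_Q A(Q) ∑_{P | Q} e(P|Q) P` of a divisor `A` of a
subextension `K`. -/
def Divisor.conormCoeff {K : IntermediateField k F} (A : Divisor k K) (P : Place k F) : ℤ :=
  A.sum fun Q a => if P.LiesOver Q then (P.ramificationIndex Q : ℤ) * a else 0

/-- The Riemann-Roch space `L(D) = {z ≠ 0 : (z) ≥ -D} ∪ {0}`. -/
def riemannRochSpace (D : Divisor k F) : Submodule k F where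
  carrier := {z | z = 0 ∨ ∀ P : Place k F, -D P ≤ P.ord z}
  zero_mem' := Or.inl rfl
  add_mem' := by
    intro a b ha hb
    by_cases hab : a + b = 0
    · exact Or.inl hab
    rcases ha with rfl | ha
    · simpa using hb
    rcases hb with rfl | hb
    · simpa using Or.inr ha
    by_cases ha0 : a = 0
    · subst ha0; simpa using Or.inr hb
    by_cases hb0 : b = 0
    · subst hb0; simpa using Or.inr ha
    refine Or.inr fun P => ?_
    have h1 := ha P
    have h2 := hb P
    have hadd := P.val.map_add a b
    unfold Place.ord at *
    have hn : ∀ z : F, z ≠ 0 → P.val z ≠ 0 := fun z hz => (P.val.ne_zero_iff).2 hz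
    rcases le_max_iff.1 hadd with h | h
    · have := (WithZero.log_le_log (hn _ hab) (hn _ ha0)).2 h
      linarith
    · have := (WithZero.log_le_log (hn _ hab) (hn _ hb0)).2 h
      linarith
  smul_mem' := by
    intro c z hz
    by_cases hc : c = 0
    · left; simp [hc]
    rcases hz with rfl | hz
    · left; simp
    by_cases hz0 : z = 0
    · left; simp [hz0]
    refine Or.inr fun P => ?_
    have hle : ∀ a : k, P.val (algebraMap k F a) ≤ 1 := fun a =>
      (IsDiscreteValuationRing.maximalIdeal P.ring).valuation_le_one (K := F)
        (⟨algebraMap k F a, P.const_mem a⟩ : P.ring)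
    have hc0 : algebraMap k F c ≠ 0 := by simpa using hc
    have h1 : P.val (algebraMap k F c) = 1 := by
      refine le_antisymm (hle c) ?_
      have := hle c⁻¹
      rw [map_inv₀, map_inv₀] at this
      have hpos : 0 < P.val (algebraMap k F c) := zero_lt_iff.2 ((P.val.ne_zero_iff).2 hc0)
      exact (inv_le_one₀ hpos).1 this
    have := hz P
    simpa [Place.ord, Algebra.smul_def, h1] using this

/-- The group `G` is the (internal) semidirect product `H₁ ⋊ H₂` of its subgroups `H₁`, `H₂`,
with `H₁` normal in `G`. -/
structure IsSemidirectProduct {A : Type*} [Group A] (G H₁ H₂ : Subgroup A) : Prop where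
  le_left : H₁ ≤ G
  le_right : H₂ ≤ G
  normal : ∀ g ∈ G, ∀ h ∈ H₁, g * h * g⁻¹ ∈ H₁
  inf_eq : H₁ ⊓ H₂ = ⊥
  exists_mul : ∀ g ∈ G, ∃ h₁ ∈ H₁, ∃ h₂ ∈ H₂, g = h₁ * h₂

/-- The `k`-subspace `{∑_{l < r} (∑_j c_{j,l} f_j) w^l : c_{j,l} ∈ k}` of `F`. -/
def functionSpace {m : ℕ} (f : Fin m → F) (w : F) (r : ℕ) : Submodule k F where
  carrier := {z | ∃ c : Fin m → Fin r → k, z = ∑ l : Fin r, (∑ j, c j l • f j) * w ^ (l : ℕ)}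
  zero_mem' := ⟨0, by simp⟩
  add_mem' := by
    rintro _ _ ⟨c, rfl⟩ ⟨c', rfl⟩
    exact ⟨c + c', by simp [add_smul, Finset.sum_add_distrib, add_mul]⟩
  smul_mem' := by
    rintro a _ ⟨c, rfl⟩
    refine ⟨a • c, ?_⟩
    simp [Finset.smul_sum, mul_smul, ← smul_mul_assoc]

/-- The evaluation map `f ↦ (f(P_1), …, f(P_n))`. -/
def evaluation {n : ℕ} (P : Fin n → Place k F) (f : F) : Fin n → k := fun j => (P j).value f

/-! ### Locally repairable codes -/

/-- `C(i, α)`: the codewords of `C` whose `i`-th coordinate is `α`. -/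
def codewordsWith {α : Type*} {n : ℕ} (C : Set (Fin n → α)) (i : Fin n) (a : α) :
    Set (Fin n → α) := {c ∈ C | c i = a}

/-- A code has availability `t` and locality `(r_1, …, r_t)` if every coordinate `i` has pairwise
disjoint recovering sets `I_1, …, I_t` not containing `i`, with `|I_j| ≤ r_j`, such that for
`a ≠ b` the projections of `C(i, a)` and `C(i, b)` to `I_j` are disjoint. -/
def IsLocallyRepairable {α : Type*} {n t : ℕ} (C : Set (Fin n → α)) (r : Fin t → ℕ) : Prop :=
  ∀ i : Fin n, ∃ I : Fin t → Finset (Fin n),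
    (∀ j j', j ≠ j' → Disjoint (I j) (I j')) ∧
    ∀ j, i ∉ I j ∧ (I j).card ≤ r j ∧
      ∀ a b : α, a ≠ b →
        Disjoint ((I j).restrict '' codewordsWith C i a) ((I j).restrict '' codewordsWith C i b)

open Classical in
/-- The minimum Hamming distance between distinct codewords of a code with at least two
codewords. -/
def minDist {α : Type*} {n : ℕ} (C : Set (Fin n → α)) : ℕ :=
  sInf {e | ∃ x ∈ C, ∃ y ∈ C, x ≠ y ∧ hammingDist x y = e}

/-- `C` is a linear `[n, K, ≥ d; (r_1, …, r_t)]` locally repairable code over `k`: a linear code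
of length `n`, dimension `K`, minimum distance at least `d`, availability `t` and locality
`(r_1, …, r_t)`. -/
structure IsLRC {n t : ℕ} (C : Submodule k (Fin n → k)) (K d : ℕ) (r : Fin t → ℕ) : Prop where
  finrank_eq : Module.finrank k C = K
  le_minDist : d ≤ minDist (C : Set (Fin n → k))
  locallyRepairable : IsLocallyRepairable (C : Set (Fin n → k)) r

end FunctionFieldCode

end

/-! Length, rationality and disjointness come from the action of `G`. It is transitive on the places
over each `Q_j` by a norm argument (`Place.exists_map_eq`). Complete splitting makes the number of
these places equal to `[F : E] = |G|`, so the action is also free (`SplitsCompletely.map_injOn`).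
Their residue fields are `k`, since a larger one would give more than `[F : E]` elements independent
over `E` (`SplitsCompletely.isRational`).

Distance: `V` lies in `L(D)`, and a nonzero `g` in `L(D)` has at most `deg D = n - d` zeros
(`card_zeros_le_degree`). This bound is obtained by counting dimensions. For a finite set `S` of
zeros of `g`, functions separating `S` are independent over `k(g)`. Multiplying them by `1, g, ...,
g^l` gives `|S|(l + 1)` elements independent over `k` in some `L(lD + C)`, whose dimension is at
most `l deg D + deg C + 1`; letting `l` grow yields `|S| ≤ deg D`. The dimension bound rests on
`L(0) = k`, that is, on every nonconstant function having a pole (`IsFunctionField.exists_pole`).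

Recovery: on the `H_i`-orbit of a place of `𝒫` the coefficients, lying in `F_i`, have constant
values. Hence for `r_i ≥ 2` a function of `V_i` restricts there to a polynomial of degree less than
`r_i` in the value of `w_i`, taken at `r_i + 1` distinct points; zeros at `r_i` of them force it to
vanish (`hasValue_zero_of_orbit`). For `r_i = 1` the function is itself constant on the orbit. The
recovering sets are the two orbits with the base place removed. They are disjoint because the action
is free and `H₁ ∩ H₂ = 1`. -/

noncomputable section

namespace FunctionFieldCode

variable {k F : Type*} [Field k] [Field F] [Algebra k F]

/-! ### Valuations of places -/

namespace Place

theorem val_le_one_iff (P : Place k F) (z : F) : P.val z ≤ 1 ↔ z ∈ P.ring := by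
  constructor
  · intro h
    obtain ⟨a, rfl⟩ := IsDiscreteValuationRing.exists_lift_of_le_one h
    exact a.2
  · intro h
    exact (IsDiscreteValuationRing.maximalIdeal P.ring).valuation_le_one (K := F) ⟨z, h⟩

theorem isEquiv_val (P : Place k F) : P.val.IsEquiv P.ring.valuation :=
  Valuation.isEquiv_of_val_le_one fun {z} => by
    rw [val_le_one_iff, ValuationSubring.valuation_le_one_iff]

theorem val_lt_one_iff (P : Place k F) (z : F) : P.val z < 1 ↔ P.ring.valuation z < 1 :=
  P.isEquiv_val.lt_one_iff_lt_one

theorem mem_maximalIdeal_iff (P : Place k F) (z : P.ring) :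
    z ∈ IsLocalRing.maximalIdeal P.ring ↔ P.val (z : F) < 1 := by
  rw [val_lt_one_iff, ValuationSubring.valuation_lt_one_iff]

theorem val_algebraMap_le_one (P : Place k F) (a : k) : P.val (algebraMap k F a) ≤ 1 :=
  (P.val_le_one_iff _).2 (P.const_mem a)

theorem val_algebraMap (P : Place k F) {a : k} (ha : a ≠ 0) : P.val (algebraMap k F a) = 1 := by
  refine le_antisymm (P.val_algebraMap_le_one a) ?_
  have h := P.val_algebraMap_le_one a⁻¹
  rw [map_inv₀, map_inv₀] at h
  have h0 : 0 < P.val (algebraMap k F a) := zero_lt_iff.2 ((P.val.ne_zero_iff).2 (by simpa using ha))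
  exact (inv_le_one₀ h0).1 h

theorem val_algebraMap_lt_one_iff (P : Place k F) {a : k} :
    P.val (algebraMap k F a) < 1 ↔ a = 0 := by
  refine ⟨fun h => ?_, fun h => by simp [h]⟩
  by_contra ha
  exact h.ne (P.val_algebraMap ha)

theorem val_smul_le (P : Place k F) (a : k) (z : F) : P.val (a • z) ≤ P.val z := by
  rw [Algebra.smul_def, map_mul]
  exact mul_le_of_le_one_left' (P.val_algebraMap_le_one a)

theorem exists_val_eq (P : Place k F) (n : ℤ) : ∃ z : F, z ≠ 0 ∧ P.val z = WithZero.exp n := by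
  obtain ⟨z, hz⟩ := IsDedekindDomain.HeightOneSpectrum.valuation_surjective F
    (IsDiscreteValuationRing.maximalIdeal P.ring) (WithZero.exp n)
  refine ⟨z, ?_, hz⟩
  rintro rfl
  simp at hz
  exact WithZero.exp_ne_zero hz.symm

theorem neg_le_ord_iff (P : Place k F) {z : F} (hz : z ≠ 0) (a : ℤ) :
    -a ≤ P.ord z ↔ P.val z ≤ WithZero.exp a := by
  rw [ord, neg_le_neg_iff, WithZero.log_le_iff_le_exp ((P.val.ne_zero_iff).2 hz)]

/-- Discrete valuation rings of `F` are maximal among proper subrings. If `z` lay in `O_Q` but not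
in `O_P`, then every `y = (y z⁻ⁿ) zⁿ` with `n` large would lie in `O_Q`, which fails for a `y` with
a pole at `Q`. -/
theorem le_of_val (P Q : Place k F) (h : ∀ z, P.val z ≤ 1 → Q.val z ≤ 1) : P = Q := by
  ext z
  rw [← val_le_one_iff, ← val_le_one_iff]
  refine ⟨h z, fun hz => ?_⟩
  by_contra hz'
  rw [not_le] at hz'
  obtain ⟨y, hy0, hy⟩ := Q.exists_val_eq 1
  have hz0 : z ≠ 0 := by rintro rfl; simp at hz'
  have hpz : 0 < P.val z := zero_lt_iff.2 ((P.val.ne_zero_iff).2 hz0)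
  obtain ⟨n, hn⟩ : ∃ n : ℕ, P.val y ≤ P.val z ^ n := by
    obtain ⟨n, hn⟩ := MulArchimedean.arch (P.val y) hz'
    exact ⟨n, hn⟩
  have h1 : P.val (y * z⁻¹ ^ n) ≤ 1 := by
    rw [map_mul, map_pow, map_inv₀, inv_pow]
    exact mul_inv_le_one_of_le₀ hn zero_le
  have h2 : Q.val y ≤ 1 := by
    have : y = (y * z⁻¹ ^ n) * z ^ n := by
      rw [mul_assoc, ← mul_pow, inv_mul_cancel₀ hz0, one_pow, mul_one]
    rw [this, map_mul, map_pow]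
    exact mul_le_one' (h _ h1) (pow_le_one' hz n)
  rw [hy] at h2
  exact absurd h2 (by rw [not_le, ← WithZero.exp_zero, WithZero.exp_lt_exp]; norm_num)

theorem mem_riemannRochSpace_iff (D : Divisor k F) (z : F) :
    z ∈ riemannRochSpace D ↔ ∀ P : Place k F, P.val z ≤ WithZero.exp (D P) := by
  by_cases hz : z = 0
  · subst hz
    simp
  · change (z = 0 ∨ ∀ P : Place k F, -D P ≤ P.ord z) ↔ _
    simp only [hz, false_or]
    exact forall_congr' fun P => P.neg_le_ord_iff hz _

/-! ### Weak approximation -/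

theorem exists_lt_one_one_lt {P Q : Place k F} (h : P ≠ Q) :
    ∃ z : F, P.val z < 1 ∧ 1 < Q.val z := by
  have h1 : ∃ a, P.val a ≤ 1 ∧ 1 < Q.val a := by
    by_contra! hc
    exact h (le_of_val P Q hc)
  have h2 : ∃ b, Q.val b ≤ 1 ∧ 1 < P.val b := by
    by_contra! hc
    exact h (le_of_val Q P hc).symm
  obtain ⟨a, ha, ha'⟩ := h1
  obtain ⟨b, hb, hb'⟩ := h2
  have hb0 : b ≠ 0 := by rintro rfl; simp at hb'
  have hQb : 0 < Q.val b := zero_lt_iff.2 ((Q.val.ne_zero_iff).2 hb0)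
  refine ⟨a / b, ?_, ?_⟩
  · rw [map_div₀]
    exact (div_lt_one₀ (zero_lt_one.trans hb')).2 (ha.trans_lt hb')
  · rw [map_div₀]
    exact (one_lt_div₀ hQb).2 (hb.trans_lt ha')

theorem exists_lt_one_forall_one_lt (P : Place k F) (S : Finset (Place k F)) (hP : P ∉ S) :
    ∃ z : F, P.val z < 1 ∧ ∀ Q ∈ S, 1 < Q.val z := by
  classical
  induction S using Finset.induction_on with
  | empty => exact ⟨0, by simp, by simp⟩
  | insert R S hR ih =>
    rw [Finset.mem_insert, not_or] at hP
    obtain ⟨y, hy, hyS⟩ := ih hP.2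
    obtain ⟨z, hz, hzR⟩ := exists_lt_one_one_lt hP.1
    -- Where `z` has a pole, a high power of it dominates `y`; elsewhere `z ^ n` is integral and the
    -- pole of `y` survives.
    have key : ∀ Q ∈ insert R S, ∃ N : ℕ, ∀ n ≥ N, 1 ≤ n → 1 < Q.val (y + z ^ n) := by
      intro Q hQ
      rcases lt_or_ge 1 (Q.val z) with h | h
      · obtain ⟨N, hN⟩ := MulArchimedean.arch (Q.val y) h
        refine ⟨N + 1, fun n hn h1 => ?_⟩
        have hlt : Q.val y < Q.val (z ^ n) := by
          rw [map_pow]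
          exact hN.trans_lt (pow_lt_pow_right₀ h (by omega))
        rw [Valuation.map_add_eq_of_lt_right _ hlt, map_pow]
        exact one_lt_pow₀ h (by omega)
      · have hQS : Q ∈ S := by
          rcases Finset.mem_insert.1 hQ with rfl | h'
          · exact absurd hzR (not_lt.2 h)
          · exact h'
        refine ⟨0, fun n _ _ => ?_⟩
        have hlt : Q.val (z ^ n) < Q.val y := by
          rw [map_pow]
          exact (pow_le_one' h n).trans_lt (hyS Q hQS)
        rw [Valuation.map_add_eq_of_lt_left _ hlt]
        exact hyS Q hQS
    choose! N hN using key
    refine ⟨y + z ^ ((insert R S).sup N + 1), ?_, fun Q hQ =>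
      hN Q hQ _ ((Finset.le_sup hQ).trans (Nat.le_succ _)) (by omega)⟩
    refine P.val.map_add_lt hy ?_
    rw [map_pow]
    exact pow_lt_one₀ zero_le hz (by omega)

/-- Take `(1 + u)⁻¹` with `u` vanishing at `P` and having poles at the other places of `S`. -/
theorem exists_val_sub_one_lt_one (P : Place k F) (S : Finset (Place k F)) :
    ∃ z : F, P.val (z - 1) < 1 ∧ ∀ Q ∈ S, Q ≠ P → Q.val z < 1 := by
  classical
  obtain ⟨u, hu, huS⟩ := exists_lt_one_forall_one_lt P (S.erase P) (by simp)
  have h1 : P.val (1 + u) = 1 := P.val.map_one_add_of_lt hu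
  have h1' : 1 + u ≠ 0 := by
    intro h
    simp [h] at h1
  refine ⟨(1 + u)⁻¹, ?_, fun Q hQ hQP => ?_⟩
  · have : (1 + u)⁻¹ - 1 = -(u * (1 + u)⁻¹) := by
      field_simp
      ring
    rw [this, Valuation.map_neg, map_mul, map_inv₀, h1]
    simpa using hu
  · have h := huS Q (Finset.mem_erase.2 ⟨hQP, hQ⟩)
    rw [map_inv₀, Valuation.map_add_eq_of_lt_right _ (by simpa using h)]
    exact inv_lt_one_of_one_lt₀ h

theorem val_eq_one_of_val_sub_one_lt_one (P : Place k F) {z : F} (h : P.val (z - 1) < 1) :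
    P.val z = 1 := by
  have := P.val.map_one_add_of_lt h
  simpa using this

end Place

/-! ### Elements transcendental over the constants -/

section

namespace IsFunctionField

theorem essFiniteType (hF : IsFunctionField k F) : Algebra.EssFiniteType k F := by
  obtain ⟨x, -, hx⟩ := hF.exists_finite
  have h1 : Algebra.EssFiniteType k (IntermediateField.adjoin k {x}) :=
    IntermediateField.essFiniteType_iff.2
      (IntermediateField.fg_adjoin_of_finite (Set.finite_singleton x))
  exact Algebra.EssFiniteType.comp k (IntermediateField.adjoin k {x}) F

/-- The transcendence degree is one, so any single transcendental element is a transcendence basis.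
-/
theorem isAlgebraic_adjoin (hF : IsFunctionField k F) {y : F} (hy : Transcendental k y) :
    Algebra.IsAlgebraic (IntermediateField.adjoin k {y}) F := by
  obtain ⟨x, hx, hfin⟩ := hF.exists_finite
  have hxi : AlgebraicIndependent k (fun _ : Fin 1 => x) :=
    algebraicIndependent_unique_type_iff.2 hx
  have hyi : AlgebraicIndependent k (fun _ : Fin 1 => y) :=
    algebraicIndependent_unique_type_iff.2 hy
  have hr : ∀ z : F, Set.range (fun _ : Fin 1 => z) = {z} := fun z => Set.range_const
  have hxb : IsTranscendenceBasis k (fun _ : Fin 1 => x) := by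
    rw [hxi.isTranscendenceBasis_iff_isAlgebraic, hr]
    exact IntermediateField.isAlgebraic_adjoin_iff_top.1 inferInstance
  have hyb : IsTranscendenceBasis k (fun _ : Fin 1 => y) :=
    hyi.isTranscendenceBasis_of_lift_trdeg_le_of_finite (hxb.lift_cardinalMk_eq_trdeg).symm.le
  have := hyb.isAlgebraic_field
  rwa [hr] at this

theorem finiteDimensional_adjoin (hF : IsFunctionField k F) {y : F} (hy : Transcendental k y) :
    FiniteDimensional (IntermediateField.adjoin k {y}) F := by
  have := hF.isAlgebraic_adjoin hy
  have := hF.essFiniteType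
  have : Algebra.EssFiniteType (IntermediateField.adjoin k {y}) F :=
    Algebra.EssFiniteType.of_comp k _ F
  exact Algebra.finite_of_essFiniteType_of_isAlgebraic

theorem transcendental_of_forall_ne (hF : IsFunctionField k F) {y : F}
    (hy : ∀ a, y ≠ algebraMap k F a) : Transcendental k y := by
  intro h
  have : y ∈ algebraicClosure k F := (mem_algebraicClosure_iff).2 h
  rw [hF.fullConstants, IntermediateField.mem_bot] at this
  obtain ⟨a, ha⟩ := this
  exact hy a ha.symm

theorem transcendental_of_val_lt_one (hF : IsFunctionField k F) (P : Place k F) {y : F}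
    (hy0 : y ≠ 0) (hy : P.val y < 1) : Transcendental k y :=
  hF.transcendental_of_forall_ne fun a ha => hy0 <| by
    rw [ha, P.val_algebraMap_lt_one_iff] at hy
    rw [ha, hy, map_zero]

end IsFunctionField

namespace Place

theorem residue_eq_zero_iff (P : Place k F) (z : P.ring) :
    IsLocalRing.residue P.ring z = 0 ↔ P.val (z : F) < 1 := by
  rw [IsLocalRing.residue_eq_zero_iff, mem_maximalIdeal_iff]

/-- The inclusion of the valuation ring of a place, as a linear map. -/
def subtypeₗ (P : Place k F) : P.ring →ₗ[k] F where
  toFun := (↑)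
  map_add' _ _ := rfl
  map_smul' a z := by
    rw [Algebra.smul_def, RingHom.id_apply, Algebra.smul_def]
    rfl

@[simp]
theorem coe_subtypeₗ (P : Place k F) (z : P.ring) : P.subtypeₗ z = z := rfl

/-- The residue map of a place, as a linear map. -/
def residueₗ (P : Place k F) : P.ring →ₗ[k] IsLocalRing.ResidueField P.ring :=
  (IsScalarTower.toAlgHom k P.ring (IsLocalRing.ResidueField P.ring)).toLinearMap

@[simp]
theorem coe_residueₗ (P : Place k F) (z : P.ring) :
    P.residueₗ z = IsLocalRing.residue P.ring z := rfl

end Place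

/-! ### Linear independence over `k(y)` -/

open Polynomial

theorem exists_eq_X_pow_mul {ι : Type*} (p : ι → k[X]) (hp : p ≠ 0) :
    ∃ m : ℕ, ∃ q : ι → k[X], (∀ a, p a = X ^ m * q a) ∧ ∃ a, (q a).coeff 0 ≠ 0 := by
  classical
  have hex : ∃ m, ∃ a, (p a).coeff m ≠ 0 := by
    by_contra! h
    exact hp (funext fun a => Polynomial.ext fun m => by simpa using h m a)
  have hdvd : ∀ a, X ^ Nat.find hex ∣ p a := fun a =>
    X_pow_dvd_iff.2 fun d hd => by
      by_contra h
      exact Nat.find_min hex hd ⟨a, h⟩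
  choose q hq using hdvd
  refine ⟨_, q, hq, ?_⟩
  obtain ⟨a, ha⟩ := Nat.find_spec hex
  refine ⟨a, ?_⟩
  rw [hq a, coeff_X_pow_mul'] at ha
  simpa using ha

/-- Clearing denominators and dividing by the largest common power of `y` normalizes a nonzero
coefficient vector over `k(y)` so that its reduction modulo `y`, the vector of constant terms, is
nonzero. -/
theorem exists_mul_eq_aeval {ι : Type*} [Finite ι] {y : F} (hy : Transcendental k y)
    (e : ι → IntermediateField.adjoin k {y}) (he : e ≠ 0) :
    ∃ s : IntermediateField.adjoin k {y}, s ≠ 0 ∧ ∃ q : ι → k[X], (∃ a, (q a).coeff 0 ≠ 0) ∧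
      ∀ a, ((s * e a : IntermediateField.adjoin k {y}) : F) = aeval y (q a) := by
  classical
  have := Fintype.ofFinite ι
  have h1 : ∀ a, ∃ r t : k[X], t ≠ 0 ∧ (e a : F) = aeval y r / aeval y t := by
    intro a
    obtain ⟨r, t, h⟩ := (IntermediateField.mem_adjoin_simple_iff k _).1 (e a).2
    by_cases ht : t = 0
    · exact ⟨0, 1, one_ne_zero, by simp [h, ht]⟩
    · exact ⟨r, t, ht, h⟩
  choose r t ht hrt using h1
  have hinj : ∀ p : k[X], p ≠ 0 → aeval y p ≠ 0 := fun p hp h => hp (transcendental_iff.1 hy p h)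
  have hy0 : y ≠ 0 := by
    rintro rfl
    exact hy isAlgebraic_zero
  let T : k[X] := ∏ a, t a
  let p : ι → k[X] := fun a => r a * ∏ b ∈ Finset.univ.erase a, t b
  have hT : T ≠ 0 := Finset.prod_ne_zero_iff.2 fun a _ => ht a
  have hpT : ∀ a, aeval y T * (e a : F) = aeval y (p a) := by
    intro a
    rw [hrt a, mul_div_assoc', div_eq_iff (hinj _ (ht a))]
    simp only [T, p, ← Finset.mul_prod_erase Finset.univ t (Finset.mem_univ a), map_mul]
    ring
  have hp : p ≠ 0 := by
    intro h
    apply he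
    funext a
    have h2 := hpT a
    rw [h] at h2
    simpa [hinj T hT] using h2
  obtain ⟨m, q, hq, a, ha⟩ := exists_eq_X_pow_mul p hp
  have hmem : ∀ p : k[X], aeval y p ∈ IntermediateField.adjoin k {y} := fun p =>
    (IntermediateField.mem_adjoin_simple_iff k _).2 ⟨p, 1, by simp⟩
  refine ⟨⟨aeval y T, hmem T⟩ / ⟨aeval y (X ^ m), hmem _⟩, ?_, q, ⟨a, ha⟩, fun b => ?_⟩
  · rw [div_ne_zero_iff]
    exact ⟨fun h => hinj T hT (congrArg Subtype.val h),
      fun h => hinj _ (pow_ne_zero m X_ne_zero) (congrArg Subtype.val h)⟩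
  · have := hpT b
    rw [hq b, map_mul] at this
    have hX := hinj _ (pow_ne_zero m X_ne_zero)
    simp only [MulMemClass.coe_mul, IntermediateField.coe_div]
    rw [div_mul_eq_mul_div, this, mul_div_cancel_left₀ _ hX]

theorem val_aeval_le_one {Γ₀ : Type*} [LinearOrderedCommGroupWithZero Γ₀] (v : Valuation F Γ₀)
    (hv : ∀ a : k, v (algebraMap k F a) ≤ 1) {y : F} (hy : v y ≤ 1) (q : k[X]) :
    v (aeval y q) ≤ 1 := by
  rw [aeval_eq_sum_range]
  refine v.map_sum_le fun i _ => ?_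
  rw [Algebra.smul_def, map_mul, map_pow]
  exact mul_le_one' (hv _) (pow_le_one' hy i)

theorem val_aeval_sub_coeff_le {Γ₀ : Type*} [LinearOrderedCommGroupWithZero Γ₀]
    (v : Valuation F Γ₀) (hv : ∀ a : k, v (algebraMap k F a) ≤ 1) {y : F} (hy : v y ≤ 1)
    (q : k[X]) : v (aeval y q - algebraMap k F (q.coeff 0)) ≤ v y := by
  have : aeval y q - algebraMap k F (q.coeff 0) = aeval y q.divX * y := by
    conv_lhs => rw [← divX_mul_X_add q]
    simp
  rw [this, map_mul]
  exact mul_le_of_le_one_left' (val_aeval_le_one v hv hy _)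

/-- A family is linearly independent over `K` if, after scaling, every relation over `K` reduces
modulo the places of `S` to a nontrivial relation over `k`, and there are no such relations. -/
theorem linearIndependent_of_reduction {K : Type*} [Field K] [Algebra K F] {ι : Type*} [Fintype ι]
    (u : ι → F) (S : Set (Place k F))
    (hK : ∀ e : ι → K, e ≠ 0 → ∃ s : K, s ≠ 0 ∧ ∃ c : ι → k, c ≠ 0 ∧
      ∀ P ∈ S, ∀ a, P.val (algebraMap K F (s * e a) - algebraMap k F (c a)) < 1)
    (hu : ∀ c : ι → k, c ≠ 0 → ∃ P ∈ S, (∀ a, P.val (u a) ≤ 1) ∧ 1 ≤ P.val (∑ a, c a • u a)) :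
    LinearIndependent K u := by
  rw [Fintype.linearIndependent_iff]
  by_contra! h
  obtain ⟨e, he, a, hea⟩ := h
  obtain ⟨s, -, c, hc, hP⟩ := hK e fun h => hea (congrFun h a)
  obtain ⟨P, hPS, hu1, huc⟩ := hu c hc
  have hsum : ∑ a, c a • u a =
      ∑ a, -((algebraMap K F (s * e a) - algebraMap k F (c a)) * u a) := by
    have h0 : ∑ a, algebraMap K F (s * e a) * u a = 0 := by
      have : ∑ a, algebraMap K F (s * e a) * u a = algebraMap K F s * ∑ a, e a • u a := by
        rw [Finset.mul_sum]
        exact Finset.sum_congr rfl fun a _ => by rw [map_mul, Algebra.smul_def, mul_assoc]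
      rw [this, he, mul_zero]
    simp only [sub_mul, neg_sub, Finset.sum_sub_distrib, h0, sub_zero, Algebra.smul_def]
  rw [hsum] at huc
  refine huc.not_gt (P.val.map_sum_lt one_ne_zero fun a _ => ?_)
  rw [Valuation.map_neg, map_mul]
  exact mul_lt_one_of_lt_of_le (hP P hPS a) (hu1 a)

theorem linearIndependent_adjoin {ι : Type*} [Fintype ι] {y : F} (hy : Transcendental k y)
    (u : ι → F)
    (hu : ∀ c : ι → k, c ≠ 0 → ∃ P : Place k F, P.val y < 1 ∧ (∀ a, P.val (u a) ≤ 1) ∧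
      1 ≤ P.val (∑ a, c a • u a)) :
    LinearIndependent (IntermediateField.adjoin k {y}) u := by
  refine linearIndependent_of_reduction (k := k) u {P | P.val y < 1} (fun e he => ?_) hu
  obtain ⟨s, hs, q, ⟨a, ha⟩, hq⟩ := exists_mul_eq_aeval hy e he
  refine ⟨s, hs, fun a => (q a).coeff 0, fun h => ha (congrFun h a), fun P hP a => ?_⟩
  change P.val (((s * e a : IntermediateField.adjoin k {y}) : F) - _) < 1
  rw [hq a]
  exact (val_aeval_sub_coeff_le P.val P.val_algebraMap_le_one (le_of_lt hP) _).trans_lt hP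

/-- Functions that separate the places of `S`, in the sense of weak approximation. -/
theorem exists_separating (S : Finset (Place k F)) :
    ∃ u : S → F, (∀ P : S, P.1.val (u P - 1) < 1) ∧ ∀ P Q : S, P ≠ Q → Q.1.val (u P) < 1 := by
  choose u hu hu' using fun P : S => P.1.exists_val_sub_one_lt_one S
  exact ⟨u, hu, fun P Q h => hu' P Q Q.2 fun h' => h (Subtype.ext h'.symm)⟩

/-- Modulo `P` only the term `c P • u P` survives. -/
theorem one_le_val_sum {S : Finset (Place k F)} {u : S → F}
    (hu : ∀ P : S, P.1.val (u P - 1) < 1) (hu' : ∀ P Q : S, P ≠ Q → Q.1.val (u P) < 1)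
    (c : S → k) (P : S) (hc : c P ≠ 0) : 1 ≤ P.1.val (∑ a, c a • u a) := by
  classical
  have h1 : P.1.val (c P • u P) = 1 := by
    rw [Algebra.smul_def, map_mul, P.1.val_algebraMap hc,
      P.1.val_eq_one_of_val_sub_one_lt_one (hu P), one_mul]
  rw [Valuation.map_sum_eq_of_lt _ (Finset.mem_univ P), h1]
  intro a ha
  rw [h1]
  exact (P.1.val_smul_le _ _).trans_lt (hu' a P (by simpa using ha))

theorem val_separating_le_one {S : Finset (Place k F)} {u : S → F}
    (hu : ∀ P : S, P.1.val (u P - 1) < 1) (hu' : ∀ P Q : S, P ≠ Q → Q.1.val (u P) < 1)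
    (P Q : S) : Q.1.val (u P) ≤ 1 := by
  by_cases h : P = Q
  · subst h
    exact (P.1.val_eq_one_of_val_sub_one_lt_one (hu P)).le
  · exact (hu' P Q h).le

/-- This bounds the number of zeros of `y` by `[F : k(y)]`, and with powers of `y` added it drives
the count in `card_zeros_le_degree`. -/
theorem linearIndependent_separating {S : Finset (Place k F)} {u : S → F}
    (hu : ∀ P : S, P.1.val (u P - 1) < 1) (hu' : ∀ P Q : S, P ≠ Q → Q.1.val (u P) < 1)
    {y : F} (hy : Transcendental k y) (hS : ∀ P ∈ S, P.val y < 1) :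
    LinearIndependent (IntermediateField.adjoin k {y}) u := by
  refine linearIndependent_adjoin hy u fun c hc => ?_
  obtain ⟨P, hP⟩ := Function.ne_iff.1 hc
  exact ⟨P.1, hS P P.2, fun a => val_separating_le_one hu hu' a P, one_le_val_sum hu hu' c P hP⟩

/-! ### Finiteness of zeros, poles and residue degrees -/

namespace IsFunctionField

theorem finite_zeros (hF : IsFunctionField k F) {y : F} (hy : Transcendental k y) :
    {P : Place k F | P.val y < 1}.Finite := by
  have := hF.finiteDimensional_adjoin hy
  by_contra hinf
  obtain ⟨S, hS, hcard⟩ := Set.Infinite.exists_subset_card_eq hinf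
    (Module.finrank (IntermediateField.adjoin k {y}) F + 1)
  obtain ⟨u, hu, hu'⟩ := exists_separating S
  have := (linearIndependent_separating hu hu' hy fun P hP => hS hP).fintype_card_le_finrank
  simp [hcard] at this

theorem finite_poles (hF : IsFunctionField k F) (z : F) :
    {P : Place k F | 1 < P.val z}.Finite := by
  by_cases hz : ∃ a, z = algebraMap k F a
  · obtain ⟨a, rfl⟩ := hz
    convert Set.finite_empty
    ext P
    simpa using P.val_algebraMap_le_one a
  · push Not at hz
    have ht : Transcendental k z⁻¹ := hF.transcendental_of_forall_ne fun a ha =>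
      hz a⁻¹ (by rw [map_inv₀, ← ha, inv_inv])
    refine (hF.finite_zeros ht).subset fun P hP => ?_
    change P.val z⁻¹ < 1
    rw [map_inv₀]
    exact inv_lt_one_of_one_lt₀ hP

/-- For `y` vanishing at `P`, lifts of residues independent over `k` are independent over `k(y)`, so
there are at most `[F : k(y)]` of them. -/
theorem finiteDimensional_residueField (hF : IsFunctionField k F) (P : Place k F) :
    FiniteDimensional k (IsLocalRing.ResidueField P.ring) := by
  obtain ⟨y, hy0, hy⟩ := P.exists_val_eq (-1)
  have hy1 : P.val y < 1 := by
    rw [hy, ← WithZero.exp_zero, WithZero.exp_lt_exp]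
    norm_num
  have ht := hF.transcendental_of_val_lt_one P hy0 hy1
  have := hF.finiteDimensional_adjoin ht
  by_contra hinf
  have hrank : ((Module.finrank (IntermediateField.adjoin k {y}) F + 1 : ℕ) : Cardinal) ≤
      Module.rank k (IsLocalRing.ResidueField P.ring) := by
    refine (Cardinal.natCast_lt_aleph0).le.trans ?_
    rw [← not_lt]
    exact fun h => hinf (Module.rank_lt_aleph0_iff.1 h)
  obtain ⟨b, hb⟩ := le_rank_iff_exists_linearIndependent_finset.1 hrank
  choose u hu using fun a : b => IsLocalRing.residue_surjective a.1
  have hli : LinearIndependent (IntermediateField.adjoin k {y}) (fun a : b => (u a : F)) := by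
    refine linearIndependent_adjoin ht _ fun c hc => ⟨P, hy1, fun a => ?_, ?_⟩
    · exact (P.val_le_one_iff _).2 (u a).2
    · by_contra hlt
      rw [not_le] at hlt
      have hcoe : ∑ a, c a • (u a : F) = ((∑ a, c a • u a : P.ring) : F) := by
        rw [← P.coe_subtypeₗ, map_sum]
        simp
      rw [hcoe, ← P.residue_eq_zero_iff, ← P.coe_residueₗ, map_sum] at hlt
      refine hc (funext fun a => Fintype.linearIndependent_iff.1 hb.2 c ?_ a)
      simpa [hu] using hlt
  have := hli.fintype_card_le_finrank
  simp [hb.1] at this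

end IsFunctionField

end

/-! ### Discreteness of valuation rings and existence of poles -/

section

open Polynomial

/-- A valuation ring whose maximal ideal is principal and whose valuation is archimedean is a
discrete valuation ring. -/
theorem isDiscreteValuationRing_of_uniformizer (V : ValuationSubring F) {π : F} (hπ0 : π ≠ 0)
    (hπ1 : V.valuation π < 1) (hmax : ∀ z, V.valuation z < 1 → V.valuation z ≤ V.valuation π)
    (harch : ∀ z, z ≠ 0 → ∃ n : ℕ, V.valuation π ^ n ≤ V.valuation z) :
    IsDiscreteValuationRing V := by
  have hπV : π ∈ V := (V.valuation_le_one_iff _).1 hπ1.le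
  have hpos : ∀ n : ℕ, 0 < V.valuation π ^ n := fun n =>
    pow_pos (zero_lt_iff.2 ((V.valuation.ne_zero_iff).2 hπ0)) n
  have hnu : ∀ x : V, ¬ IsUnit x ↔ V.valuation (x : F) < 1 := fun x => by
    rw [← V.valuation_lt_one_iff, IsLocalRing.mem_maximalIdeal, mem_nonunits_iff]
  refine IsDiscreteValuationRing.ofHasUnitMulPowIrreducibleFactorization
    ⟨⟨π, hπV⟩, ⟨(hnu _).2 hπ1, fun a b hab => ?_⟩, fun {z} hz => ?_⟩
  · by_contra! h
    have ha := (hnu a).1 h.1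
    have hb := (hnu b).1 h.2
    have hab' : V.valuation π = V.valuation (a : F) * V.valuation (b : F) := by
      rw [← map_mul]
      exact congrArg V.valuation (congrArg Subtype.val hab)
    have : V.valuation (a : F) * V.valuation (b : F) < V.valuation π :=
      (mul_lt_of_lt_one_right (zero_lt_iff.2 fun h0 => hπ0 (by simpa [h0] using hab')) hb).trans_le
        (hmax _ ha)
    exact this.ne hab'.symm
  · classical
    have hz0 : (z : F) ≠ 0 := fun h => hz (Subtype.ext h)
    have hex := harch z hz0
    obtain ⟨n, hn⟩ : ∃ n : ℕ, V.valuation (z : F) = V.valuation (π ^ n) := by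
      refine ⟨Nat.find hex, le_antisymm ?_ (by rw [map_pow]; exact Nat.find_spec hex)⟩
      rcases hm : Nat.find hex with _ | m
      · rw [pow_zero, map_one]
        exact V.valuation_le_one z
      · have hlt := not_le.1 (Nat.find_min hex (m := m) (by omega))
        have h1 : V.valuation ((z : F) / π ^ m) < 1 := by
          rw [map_div₀, map_pow]
          exact (div_lt_one₀ (hpos m)).2 hlt
        have h2 := hmax _ h1
        rw [map_div₀, map_pow, div_le_iff₀ (hpos m)] at h2
        rwa [map_pow, pow_succ']
    obtain ⟨u, hu⟩ := (V.valuation_eq_iff _ _).1 hn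
    refine ⟨n, u, Subtype.ext ?_⟩
    rw [mul_comm]
    exact hu

/-- A normalized relation, reduced modulo `y`, gives a nontrivial constant combination of value at
most `v y`. But its terms have distinct values, so its value is the largest of these, which exceeds
`v y`. -/
theorem linearIndependent_of_injective_val {y : F} (hy : Transcendental k y)
    {Γ₀ : Type*} [LinearOrderedCommGroupWithZero Γ₀] (v : Valuation F Γ₀)
    (hv : ∀ a : k, v (algebraMap k F a) ≤ 1) {ι : Type*} [Fintype ι] (u : ι → F)
    (hinj : Function.Injective fun a => v (u a)) (hu : ∀ a, v y < v (u a)) (hu1 : ∀ a, v (u a) ≤ 1) :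
    LinearIndependent (IntermediateField.adjoin k {y}) u := by
  classical
  have hv1 : ∀ a : k, a ≠ 0 → v (algebraMap k F a) = 1 := fun a ha => by
    refine le_antisymm (hv a) ?_
    have h := hv a⁻¹
    rw [map_inv₀, map_inv₀] at h
    exact (inv_le_one₀ (zero_lt_iff.2 ((v.ne_zero_iff).2 (by simpa using ha)))).1 h
  rw [Fintype.linearIndependent_iff]
  by_contra! h
  obtain ⟨e, he, a₀, hea⟩ := h
  obtain ⟨s, -, q, ⟨a, ha⟩, hq⟩ := exists_mul_eq_aeval hy e fun h => hea (congrFun h a₀)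
  have h0 : ∑ a, aeval y (q a) * u a = 0 := by
    have : ∑ a, aeval y (q a) * u a = (s : F) * ∑ a, e a • u a := by
      rw [Finset.mul_sum]
      exact Finset.sum_congr rfl fun a _ => by
        rw [← hq a, MulMemClass.coe_mul, mul_assoc]
        rfl
    rw [this, he, mul_zero]
  have hsum : ∑ a, algebraMap k F ((q a).coeff 0) * u a =
      ∑ a, -((aeval y (q a) - algebraMap k F ((q a).coeff 0)) * u a) := by
    simp only [sub_mul, neg_sub, Finset.sum_sub_distrib, h0, sub_zero]
  have hle : v (∑ a, algebraMap k F ((q a).coeff 0) * u a) ≤ v y := by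
    rw [hsum]
    refine v.map_sum_le fun a _ => ?_
    rw [Valuation.map_neg, map_mul]
    exact mul_le_of_le_of_le_one (val_aeval_sub_coeff_le v hv ((hu a).le.trans (hu1 a)) _) (hu1 a)
  obtain ⟨b, hb, hmax⟩ := Finset.exists_max_image
    (Finset.univ.filter fun a => (q a).coeff 0 ≠ 0) (fun a => v (u a)) ⟨a, by simpa using ha⟩
  rw [Finset.mem_filter] at hb
  have hvb : v (algebraMap k F ((q b).coeff 0) * u b) = v (u b) := by
    rw [map_mul, hv1 _ hb.2, one_mul]
  rw [Valuation.map_sum_eq_of_lt _ (Finset.mem_univ b), hvb] at hle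
  · exact absurd hle (not_le.2 (hu b))
  · intro c hc
    have hcb : c ≠ b := by simpa using hc
    rw [hvb]
    by_cases hc0 : (q c).coeff 0 = 0
    · rw [hc0, map_zero, zero_mul, map_zero]
      exact zero_le.trans_lt (hu b)
    · rw [map_mul, hv1 _ hc0, one_mul]
      exact lt_of_le_of_ne (hmax c (by simpa using hc0)) fun h => hcb (hinj h)

/-- Write `p = X ^ m * q` with `q(0) ≠ 0`; then `q(y)` is congruent to a nonzero constant, hence a
unit. -/
theorem exists_pow_le_val_aeval {y : F} {Γ₀ : Type*} [LinearOrderedCommGroupWithZero Γ₀]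
    (v : Valuation F Γ₀) (hv : ∀ a : k, v (algebraMap k F a) ≤ 1) (hy : v y < 1) {p : k[X]}
    (hp : p ≠ 0) : ∃ n : ℕ, v y ^ n ≤ v (aeval y p) := by
  obtain ⟨m, q, hq, _, ha⟩ := exists_eq_X_pow_mul (fun _ : Unit => p) fun h => hp (congrFun h ())
  refine ⟨m, ?_⟩
  have h1 : 1 ≤ v (algebraMap k F ((q ()).coeff 0)) := by
    have h := hv ((q ()).coeff 0)⁻¹
    rw [map_inv₀, map_inv₀] at h
    exact (inv_le_one₀ (zero_lt_iff.2 ((v.ne_zero_iff).2 (by simpa using ha)))).1 h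
  have h2 : 1 ≤ v (aeval y (q ())) := by
    by_contra! hlt
    have := v.map_sub_lt hlt ((val_aeval_sub_coeff_le v hv hy.le (q ())).trans_lt hy)
    rw [sub_sub_cancel] at this
    exact absurd this (not_lt.2 h1)
  rw [hq (), map_mul, map_mul, aeval_X_pow, map_pow]
  exact le_mul_of_one_le_right' h2

namespace IsFunctionField

/-- Elements with distinct values above `v y` and at most `1` are independent over `k(y)`, so only
finitely many such values exist. Hence there is a largest value below `1`, that of a uniformizer. -/
theorem isDiscreteValuationRing (hF : IsFunctionField k F) (V : ValuationSubring F)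
    (hk : ∀ a : k, algebraMap k F a ∈ V) (hV : ∃ z, z ∉ V) : IsDiscreteValuationRing V := by
  obtain ⟨z, hz⟩ := hV
  set v := V.valuation with hvdef
  have hv : ∀ a : k, v (algebraMap k F a) ≤ 1 := fun a => (V.valuation_le_one_iff _).2 (hk a)
  have hz1 : 1 < v z := by
    rw [← not_le, V.valuation_le_one_iff]
    exact hz
  have hz0 : z ≠ 0 := by
    rintro rfl
    exact hz V.zero_mem
  set y := z⁻¹ with hydef
  have hy1 : v y < 1 := by
    rw [hydef, map_inv₀]
    exact inv_lt_one_of_one_lt₀ hz1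
  have hy0 : y ≠ 0 := inv_ne_zero hz0
  have hy : Transcendental k y := hF.transcendental_of_forall_ne fun a ha => hz (by
    have : z = algebraMap k F a⁻¹ := by rw [map_inv₀, ← ha, hydef, inv_inv]
    rw [this]
    exact hk _)
  have hfd := hF.finiteDimensional_adjoin hy
  have hfin : {γ : V.ValueGroup | v y < γ ∧ γ ≤ 1}.Finite := by
    by_contra hinf
    obtain ⟨S, hS, hcard⟩ := Set.Infinite.exists_subset_card_eq hinf
      (Module.finrank (IntermediateField.adjoin k {y}) F + 1)
    choose u hu using fun γ : S => V.valuation_surjective γ.1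
    have hli := linearIndependent_of_injective_val hy v hv u
      (fun a b h => Subtype.ext (by simpa only [hvdef, hu] using h))
      (fun a => by rw [hvdef, hu]; exact (hS a.2).1) (fun a => by rw [hvdef, hu]; exact (hS a.2).2)
    have := hli.fintype_card_le_finrank
    simp [hcard] at this
  have hfin' : {γ : V.ValueGroup | v y ≤ γ ∧ γ < 1}.Finite := by
    refine (hfin.insert (v y)).subset fun γ hγ => ?_
    rcases hγ.1.eq_or_lt with h | h
    · exact Or.inl h.symm
    · exact Or.inr ⟨h, hγ.2.le⟩
  obtain ⟨γ, hγ, hmax⟩ := Set.exists_max_image _ id hfin' ⟨v y, le_rfl, hy1⟩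
  obtain ⟨π, rfl⟩ := V.valuation_surjective γ
  have hpos : 0 < v π := (zero_lt_iff.2 ((v.ne_zero_iff).2 hy0)).trans_le hγ.1
  refine isDiscreteValuationRing_of_uniformizer V ((v.ne_zero_iff).1 hpos.ne') hγ.2
    (fun x hx => ?_) fun x hx => ?_
  · rcases le_total (v y) (v x) with h | h
    · exact hmax _ ⟨h, hx⟩
    · exact h.trans hγ.1
  · have h1 : ∃ m : ℕ, v π ^ m ≤ v y := by
      by_contra! h
      refine Set.infinite_of_injective_forall_mem (f := fun n : ℕ => v π ^ (n + 1))
        (s := {γ : V.ValueGroup | v y ≤ γ ∧ γ < 1}) ?_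
        (fun n => ⟨(h _).le, pow_lt_one₀ hpos.le hγ.2 (by omega)⟩) hfin'
      exact ((pow_right_strictAnti₀ hpos hγ.2).comp_strictMono fun _ _ h =>
        Nat.succ_lt_succ h).injective
    obtain ⟨m, hm⟩ := h1
    -- Some nonzero `r` in `k[y]` makes `r x⁻¹` integral over `k[y]`, which is contained in `V`; so
    -- `r x⁻¹` lies in `V` and `v r ≤ v x`.
    have hint : ∃ p : k[X], p ≠ 0 ∧ v (aeval y p) ≤ v x := by
      have halg := hF.isAlgebraic_adjoin hy
      have halg' : Algebra.IsAlgebraic (Algebra.adjoin k {y}) F :=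
        IntermediateField.isAlgebraic_adjoin_iff_top.1 halg
      obtain ⟨r, hr, hint⟩ := (halg'.isAlgebraic x⁻¹).exists_integral_multiple
      obtain ⟨p, hp⟩ : ∃ p : k[X], aeval y p = (r : F) := by
        exact Algebra.adjoin_mem_exists_aeval k y r.2
      refine ⟨p, ?_, ?_⟩
      · rintro rfl
        exact hr (Subtype.ext (by simpa using hp.symm))
      · have hle : ∀ r : Algebra.adjoin k {y}, (r : F) ∈ V := by
          intro r
          obtain ⟨p, hp⟩ := Algebra.adjoin_mem_exists_aeval k y r.2
          rw [← hp]
          exact (V.valuation_le_one_iff _).1 (val_aeval_le_one v hv hy1.le p)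
        have hmem : r • x⁻¹ ∈ V := by
          have hint' : IsIntegral V (r • x⁻¹) := by
            obtain ⟨g, hg, hg0⟩ := hint
            let φ : Algebra.adjoin k {y} →+* V :=
              (algebraMap (Algebra.adjoin k {y}) F).codRestrict V.toSubring hle
            refine ⟨g.map φ, hg.map φ, ?_⟩
            rw [eval₂_map]
            exact hg0
          obtain ⟨t, ht⟩ := IsIntegrallyClosed.isIntegral_iff.1 hint'
          rw [← ht]
          exact t.2
        have h2 := (V.valuation_le_one_iff _).2 hmem
        have h3 : r • x⁻¹ = (r : F) * x⁻¹ := rfl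
        rw [h3, map_mul, map_inv₀, ← hp] at h2
        rw [← div_eq_mul_inv] at h2
        exact (div_le_one₀ (zero_lt_iff.2 ((v.ne_zero_iff).2 hx))).1 h2
    obtain ⟨p, hp0, hp⟩ := hint
    obtain ⟨n, hn⟩ := exists_pow_le_val_aeval v hv hy1 hp0
    refine ⟨m * n, le_trans ?_ (hn.trans hp)⟩
    rw [pow_mul]
    exact pow_le_pow_left₀ zero_le hm n

/-- The full constant field `k` is integrally closed in `F`, hence an intersection of valuation
rings of `F`. One that misses `z` is proper, so it is the ring of a place. -/
theorem exists_pole (hF : IsFunctionField k F) {z : F} (hz : ∀ a, z ≠ algebraMap k F a) :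
    ∃ P : Place k F, 1 < P.val z := by
  have hcl : IsIntegrallyClosedIn (⊥ : Subalgebra k F).toSubring F := by
    rw [Subring.isIntegrallyClosedIn_iff]
    intro x hx
    have hx' : IsIntegral k x := isIntegral_trans (A := (⊥ : Subalgebra k F)) x hx
    have : x ∈ algebraicClosure k F := mem_algebraicClosure_iff.2 hx'.isAlgebraic
    rw [hF.fullConstants] at this
    exact this
  have hzR : z ∉ (⊥ : Subalgebra k F).toSubring := by
    rintro h
    obtain ⟨a, ha⟩ := Algebra.mem_bot.1 h
    exact hz a ha.symm
  obtain ⟨V, hV, hzV⟩ := Subring.exists_le_valuationSubring_of_isIntegrallyClosedIn hzR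
  have hk : ∀ a : k, algebraMap k F a ∈ V := fun a => hV (Subalgebra.algebraMap_mem ⊥ a)
  let P : Place k F := ⟨V, hk, hF.isDiscreteValuationRing V hk ⟨z, hzV⟩⟩
  refine ⟨P, ?_⟩
  rw [← not_le, P.val_le_one_iff]
  exact hzV

/-! ### Dimensions of Riemann-Roch spaces -/

theorem riemannRochSpace_zero_le (hF : IsFunctionField k F) :
    riemannRochSpace (0 : Divisor k F) ≤ Submodule.span k {1} := by
  intro z hz
  rw [Place.mem_riemannRochSpace_iff] at hz
  by_contra h
  obtain ⟨P, hP⟩ := hF.exists_pole (z := z) fun a ha => h <| Submodule.mem_span_singleton.2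
    ⟨a, by rw [ha, Algebra.smul_def, mul_one]⟩
  exact absurd (hz P) (by simpa using hP)

end IsFunctionField

theorem riemannRochSpace_mono {A B : Divisor k F} (h : A ≤ B) :
    riemannRochSpace A ≤ riemannRochSpace B := by
  intro z hz
  rw [Place.mem_riemannRochSpace_iff] at hz ⊢
  exact fun P => (hz P).trans (WithZero.exp_le_exp.2 (h P))

/-- The map `L(A + P) → O_P / P` with kernel `L(A)`, after scaling by `t`. -/
def leadingCoeffMap (A : Divisor k F) (P : Place k F) (t : F)
    (ht : P.val t = WithZero.exp (-(A P + 1))) :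
    riemannRochSpace (A + Finsupp.single P 1) →ₗ[k] IsLocalRing.ResidueField P.ring :=
  P.residueₗ ∘ₗ
  { toFun := fun z => ⟨t * z, by
      have hz := (Place.mem_riemannRochSpace_iff _ _).1 z.2 P
      rw [← P.val_le_one_iff, map_mul, ht]
      refine (mul_le_mul_right hz _).trans ?_
      rw [← WithZero.exp_add]
      simp⟩
    map_add' := fun _ _ => Subtype.ext (by simp [mul_add])
    map_smul' := fun a z => Subtype.ext <| by
      change t * (a • (z : F)) = P.subtypeₗ (a • ⟨t * z, _⟩)
      rw [map_smul, mul_smul_comm]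
      rfl }

theorem mem_of_leadingCoeffMap_eq_zero (A : Divisor k F) (P : Place k F) (t : F)
    (ht : P.val t = WithZero.exp (-(A P + 1))) (z : riemannRochSpace (A + Finsupp.single P 1))
    (hz : leadingCoeffMap A P t ht z = 0) : (z : F) ∈ riemannRochSpace A := by
  classical
  rw [Place.mem_riemannRochSpace_iff]
  intro Q
  have hzQ := (Place.mem_riemannRochSpace_iff _ _).1 z.2 Q
  by_cases hQ : P = Q
  · subst hQ
    have h1 : P.val (t * z) < 1 := (P.residue_eq_zero_iff _).1 hz
    by_cases hz0 : (z : F) = 0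
    · simp [hz0]
    rw [map_mul, ht, ← WithZero.exp_log ((P.val.ne_zero_iff).2 hz0), ← WithZero.exp_add,
      ← WithZero.exp_zero, WithZero.exp_lt_exp] at h1
    rw [← WithZero.log_le_iff_le_exp ((P.val.ne_zero_iff).2 hz0)]
    omega
  · simpa [Finsupp.single_apply, hQ] using hzQ

/-- Rank-nullity for `leadingCoeffMap`, whose target has dimension `deg P` and whose kernel embeds
in `L(A)`. -/
theorem finrank_riemannRochSpace_add_single (hF : IsFunctionField k F) (A : Divisor k F)
    (P : Place k F) [FiniteDimensional k (riemannRochSpace A)] :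
    FiniteDimensional k (riemannRochSpace (A + Finsupp.single P 1)) ∧
      Module.finrank k (riemannRochSpace (A + Finsupp.single P 1)) ≤
        Module.finrank k (riemannRochSpace A) + P.degree := by
  have := hF.finiteDimensional_residueField P
  obtain ⟨t, -, ht⟩ := P.exists_val_eq (-(A P + 1))
  let φ := leadingCoeffMap A P t ht
  let ψ : LinearMap.ker φ →ₗ[k] riemannRochSpace A :=
    ((riemannRochSpace (A + Finsupp.single P 1)).subtype ∘ₗ (LinearMap.ker φ).subtype).codRestrict _
      fun z => mem_of_leadingCoeffMap_eq_zero A P t ht z.1 z.2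
  have hψ : Function.Injective ψ := fun a b h =>
    Subtype.ext (Subtype.ext (congrArg (fun x : riemannRochSpace A => (x : F)) h))
  have hker : FiniteDimensional k (LinearMap.ker φ) := FiniteDimensional.of_injective ψ hψ
  have hfin : FiniteDimensional k (riemannRochSpace (A + Finsupp.single P 1)) :=
    ⟨Submodule.fg_of_fg_map_of_fg_inf_ker φ (IsNoetherian.noetherian _) (by
      rw [top_inf_eq]
      exact Module.Finite.iff_fg.1 hker)⟩
  refine ⟨hfin, ?_⟩
  rw [← LinearMap.finrank_range_add_finrank_ker φ, add_comm]
  exact add_le_add (LinearMap.finrank_le_finrank_of_injective hψ) (Submodule.finrank_le _)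

/-- Multiplicities in `ℕ` let the induction add one place at a time; `A` stays general because a sum
is added in two stages. -/
theorem finrank_riemannRochSpace_add (hF : IsFunctionField k F) (B : Place k F →₀ ℕ) :
    ∀ (A : Divisor k F) [FiniteDimensional k (riemannRochSpace A)],
    FiniteDimensional k (riemannRochSpace (A + B.mapRange ((↑) : ℕ → ℤ) rfl)) ∧
      Module.finrank k (riemannRochSpace (A + B.mapRange ((↑) : ℕ → ℤ) rfl)) ≤
        Module.finrank k (riemannRochSpace A) + B.sum fun P a => a * P.degree := by
  classical
  induction B using Finsupp.induction_linear with
  | zero =>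
    intro A hA
    rw [Finsupp.mapRange_zero, add_zero]
    exact ⟨hA, by simp⟩
  | add B₁ B₂ h₁ h₂ =>
    intro A hA
    obtain ⟨h, hle⟩ := h₁ A
    obtain ⟨h', hle'⟩ := h₂ (A + B₁.mapRange ((↑) : ℕ → ℤ) rfl)
    rw [Finsupp.mapRange_add (by simp), ← add_assoc]
    refine ⟨h', hle'.trans ?_⟩
    rw [Finsupp.sum_add_index' (by simp) (fun P a b => by ring)]
    omega
  | single P n =>
    intro A hA
    rw [Finsupp.mapRange_single, Finsupp.sum_single_index (by simp)]
    induction n with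
    | zero =>
      rw [Nat.cast_zero, Finsupp.single_zero, add_zero]
      exact ⟨hA, by simp⟩
    | succ n ih =>
      have := ih.1
      rw [Nat.cast_succ, Finsupp.single_add, ← add_assoc]
      obtain ⟨h, hle⟩ := finrank_riemannRochSpace_add_single hF (A + Finsupp.single P (n : ℤ)) P
      refine ⟨h, hle.trans ?_⟩
      have := ih.2
      rw [add_mul]
      omega

theorem Divisor.degree_add (A B : Divisor k F) : (A + B).degree = A.degree + B.degree :=
  Finsupp.sum_add_index' (by simp) fun P a b => by ring

theorem Divisor.degree_nonneg {A : Divisor k F} (hA : 0 ≤ A) : 0 ≤ A.degree :=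
  Finset.sum_nonneg fun P _ => mul_nonneg (hA P) (Nat.cast_nonneg _)

theorem finrank_riemannRochSpace_le (hF : IsFunctionField k F) {A : Divisor k F} (hA : 0 ≤ A) :
    FiniteDimensional k (riemannRochSpace A) ∧
      (Module.finrank k (riemannRochSpace A) : ℤ) ≤ A.degree + 1 := by
  classical
  have h0 : FiniteDimensional k (riemannRochSpace (0 : Divisor k F)) :=
    Submodule.finiteDimensional_of_le hF.riemannRochSpace_zero_le
  have h1 : Module.finrank k (riemannRochSpace (0 : Divisor k F)) ≤ 1 :=
    (Submodule.finrank_mono hF.riemannRochSpace_zero_le).trans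
      (finrank_span_singleton (one_ne_zero)).le
  let B : Place k F →₀ ℕ := A.mapRange Int.toNat rfl
  have hAB : B.mapRange ((↑) : ℕ → ℤ) rfl = A := by
    ext P
    simpa [B] using hA P
  obtain ⟨h, hle⟩ := finrank_riemannRochSpace_add hF B 0
  rw [zero_add, hAB] at h hle
  refine ⟨h, ?_⟩
  have hdeg : A.degree = ((B.sum fun P a => a * P.degree : ℕ) : ℤ) := by
    rw [← hAB, Divisor.degree, Finsupp.sum_mapRange_index (by simp)]
    simp [Finsupp.sum]
  rw [hdeg]
  exact_mod_cast hle.trans (by omega)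

/-- A function in `L(D)`, `D` effective, has at most `deg D` zeros. -/
theorem card_zeros_le_degree (hF : IsFunctionField k F) {D : Divisor k F} (hD : 0 ≤ D) {g : F}
    (hg : g ∈ riemannRochSpace D) (hg0 : g ≠ 0) (S : Finset (Place k F))
    (hS : ∀ P ∈ S, P.val g < 1) : (S.card : ℤ) ≤ D.degree := by
  classical
  rcases S.eq_empty_or_nonempty with rfl | ⟨P, hP⟩
  · simpa using Divisor.degree_nonneg hD
  have hgt := hF.transcendental_of_val_lt_one P hg0 (hS P hP)
  obtain ⟨u, hu, hu'⟩ := exists_separating S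
  have hli := linearIndependent_separating hu hu' hgt hS
  -- The pole divisor of each separating function serves; it is a divisor because the poles are
  -- finite in number.
  have hpole : ∀ a : S, ∃ A : Divisor k F, 0 ≤ A ∧ u a ∈ riemannRochSpace A := by
    intro a
    refine ⟨Finsupp.ofSupportFinite (fun Q : Place k F => max 0 (WithZero.log (Q.val (u a))))
      ((hF.finite_poles (u a)).subset fun Q hQ => ?_), fun Q => le_max_left _ _, ?_⟩
    · change 1 < Q.val (u a)
      by_contra! h
      apply hQ
      apply max_eq_left
      by_cases h0 : Q.val (u a) = 0
      · simp [h0]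
      · exact (WithZero.log_le_iff_le_exp h0).2 (by simpa using h)
    · rw [Place.mem_riemannRochSpace_iff]
      intro Q
      by_cases h0 : Q.val (u a) = 0
      · simp [h0]
      · exact (WithZero.log_le_iff_le_exp h0).1 (le_max_right _ _)
  choose A hA huA using hpole
  let C : Divisor k F := ∑ a, A a
  have hC : 0 ≤ C := Finset.sum_nonneg fun a _ => hA a
  have huC : ∀ a, u a ∈ riemannRochSpace C := fun a =>
    riemannRochSpace_mono (Finset.single_le_sum (fun a _ => hA a) (Finset.mem_univ a)) (huA a)
  have key : ∀ l : ℕ, (S.card : ℤ) * (l + 1) ≤ l * D.degree + C.degree + 1 := by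
    intro l
    have hE : 0 ≤ l • D + C := add_nonneg (nsmul_nonneg hD l) hC
    obtain ⟨hfin, hrank⟩ := finrank_riemannRochSpace_le hF hE
    let e : S × Fin (l + 1) → riemannRochSpace (l • D + C) := fun x =>
      ⟨u x.1 * g ^ (x.2 : ℕ), by
        rw [Place.mem_riemannRochSpace_iff] at hg ⊢
        intro Q
        have h1 := (Place.mem_riemannRochSpace_iff _ _).1 (huC x.1) Q
        rw [map_mul, map_pow]
        calc Q.val (u x.1) * Q.val g ^ (x.2 : ℕ)
            ≤ WithZero.exp (C Q) * WithZero.exp (D Q) ^ (x.2 : ℕ) :=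
              mul_le_mul' h1 (pow_le_pow_left₀ zero_le (hg Q) _)
          _ ≤ WithZero.exp ((l • D + C) Q) := by
              rw [← WithZero.exp_nsmul, ← WithZero.exp_add, WithZero.exp_le_exp]
              simp only [Finsupp.coe_add, Pi.add_apply, Finsupp.smul_apply, nsmul_eq_mul]
              have h2 : ((x.2 : ℕ) : ℤ) * D Q ≤ l * D Q :=
                mul_le_mul_of_nonneg_right (by exact_mod_cast Nat.lt_succ_iff.1 x.2.2) (hD Q)
              linarith⟩
    -- A relation over `k` groups into a relation among the `u a` with coefficients in `k[g]`. These
    -- coefficients vanish, and `g` is transcendental.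
    have heli : LinearIndependent k e := by
      apply LinearIndependent.of_comp (riemannRochSpace (l • D + C)).subtype
      rw [Fintype.linearIndependent_iff]
      intro c hc
      have hmem : ∀ p : k[X], aeval g p ∈ IntermediateField.adjoin k {g} := fun p =>
        (IntermediateField.mem_adjoin_simple_iff k _).2 ⟨p, 1, by simp⟩
      let p : S → k[X] := fun a => ∑ j : Fin (l + 1), Polynomial.C (c (a, j)) * X ^ (j : ℕ)
      have hp : ∑ a, (⟨aeval g (p a), hmem _⟩ : IntermediateField.adjoin k {g}) • u a = 0 := by
        rw [← hc, Fintype.sum_prod_type]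
        refine Finset.sum_congr rfl fun a _ => ?_
        change aeval g (p a) * u a = _
        simp only [p, map_sum, map_mul, aeval_C, aeval_X_pow, Finset.sum_mul]
        refine Finset.sum_congr rfl fun j _ => ?_
        simp only [Function.comp_apply, e, Submodule.subtype_apply, Algebra.smul_def]
        ring
      have hp0 : ∀ a, p a = 0 := fun a => transcendental_iff.1 hgt _
        (congrArg Subtype.val (Fintype.linearIndependent_iff.1 hli _ hp a))
      rintro ⟨a, j⟩
      have := congrArg (fun q => q.coeff (j : ℕ)) (hp0 a)
      simpa [p, coeff_C_mul, coeff_X_pow, Fin.val_inj] using this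
    have hcard := heli.fintype_card_le_finrank
    rw [Fintype.card_prod, Fintype.card_coe, Fintype.card_fin] at hcard
    have hdeg : ∀ n : ℕ, Divisor.degree (n • D) = n * D.degree := by
      intro n
      induction n with
      | zero => simp [Divisor.degree]
      | succ n ih => rw [succ_nsmul, Divisor.degree_add, ih]; push_cast; ring
    rw [Divisor.degree_add, hdeg] at hrank
    exact le_trans (by exact_mod_cast hcard) hrank
  by_contra! hlt
  have hCd := Divisor.degree_nonneg hC
  -- If `|S| ≥ deg D + 1`, then `key` gives `l + deg D ≤ deg C`, which `l = deg C + 1` contradicts.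
  have h := key (C.degree.toNat + 1)
  rw [Nat.cast_succ, Int.toNat_of_nonneg hCd] at h
  nlinarith [Divisor.degree_nonneg hD]

end

/-! ### Restriction and transport of places -/

namespace Place

/-- The pulled-back valuation still has values in `ℤ`, and the element `x` makes it nontrivial. Used
both for subfields and for automorphisms. -/
theorem isDiscreteValuationRing_comap {K : Type*} [Field K] (φ : K →+* F) (P : Place k F)
    (h : ∃ x, φ x ∉ P.ring) : IsDiscreteValuationRing (P.ring.comap φ) := by
  let w := P.val.comap φ
  have hw : w.valuationSubring = P.ring.comap φ := by
    ext x
    rw [Valuation.mem_valuationSubring_iff, Valuation.comap_apply, P.val_le_one_iff]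
    rfl
  obtain ⟨x, hx⟩ := h
  have hx1 : 1 < w x := by
    rw [← not_le, Valuation.comap_apply, P.val_le_one_iff]
    exact hx
  have : Nontrivial (MonoidWithZeroHom.ofClass w).valueGroup := by
    rw [Subgroup.nontrivial_iff_exists_ne_one]
    refine ⟨Units.mk0 (w x) (zero_lt_one.trans hx1).ne', ?_, ?_⟩
    · exact MonoidWithZeroHom.mem_valueGroup _ ⟨x, rfl⟩
    · intro h
      exact hx1.ne' (congrArg Units.val h)
  rw [← hw]
  exact w.valuationSubring_isDiscreteValuationRing

/-- The maximal ideal is described by the valuation ring alone, so comparisons of rings transfer to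
it without comparing normalizations. -/
theorem val_lt_one_iff_inv (P : Place k F) (z : F) :
    P.val z < 1 ↔ z = 0 ∨ ¬ P.val z⁻¹ ≤ 1 := by
  by_cases hz : z = 0
  · simp [hz]
  · have h : 0 < P.val z := zero_lt_iff.2 ((P.val.ne_zero_iff).2 hz)
    rw [not_le, map_inv₀, one_lt_inv₀ h]
    simp [hz]

/-! ### Places of subfields -/

section LiesOver

variable {K : IntermediateField k F} {P : Place k F} {Q : Place k K}

theorem LiesOver.val_le_one_iff (h : P.LiesOver Q) (x : K) : P.val (x : F) ≤ 1 ↔ Q.val x ≤ 1 := by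
  rw [P.val_le_one_iff, Q.val_le_one_iff, h]
  rfl

theorem LiesOver.val_lt_one_iff (h : P.LiesOver Q) (x : K) : P.val (x : F) < 1 ↔ Q.val x < 1 := by
  rw [val_lt_one_iff_inv, val_lt_one_iff_inv, ← h.val_le_one_iff]
  simp

theorem LiesOver.eq {Q' : Place k K} (h : P.LiesOver Q) (h' : P.LiesOver Q') : Q = Q' :=
  Place.ext (h.trans h'.symm)

/-- The place of a subfield under a given place. -/
def restrict (K : IntermediateField k F) [Algebra.IsAlgebraic K F] (P : Place k F) : Place k K where
  ring := P.ring.comap (algebraMap K F)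
  const_mem := P.const_mem
  discrete := P.isDiscreteValuationRing_comap _ <| by
    -- If `K` were contained in `O_P`, then `F`, being algebraic over `K`, would be integral over
    -- `O_P` and so equal to it.
    by_contra! h
    obtain ⟨z, -, hz⟩ := P.exists_val_eq 1
    have hmem : z ∈ P.ring := by
      have hint : IsIntegral P.ring z := by
        obtain ⟨g, hg, hg0⟩ := (Algebra.IsAlgebraic.isAlgebraic (R := K) z).isIntegral
        let φ : K →+* P.ring := (algebraMap K F).codRestrict P.ring.toSubring h
        refine ⟨g.map φ, hg.map φ, ?_⟩
        rw [Polynomial.eval₂_map]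
        exact hg0
      obtain ⟨t, ht⟩ := IsIntegrallyClosed.isIntegral_iff.1 hint
      rw [← ht]
      exact t.2
    rw [← P.val_le_one_iff, hz, ← WithZero.exp_zero, WithZero.exp_le_exp] at hmem
    exact absurd hmem (by norm_num)

theorem liesOver_restrict (K : IntermediateField k F) [Algebra.IsAlgebraic K F] (P : Place k F) :
    P.LiesOver (P.restrict K) := rfl

/-- Here `e = ν_P(π)` for a uniformizer `π` of `Q`: dividing `x` by the right power of `π` leaves a
unit at `Q`, hence at `P`. -/
theorem LiesOver.exists_ord_eq (h : P.LiesOver Q) : ∃ e : ℕ, ∀ x : K, P.ord x = e * Q.ord x := by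
  obtain ⟨π, hπ0, hπ⟩ := Q.exists_val_eq (-1)
  have hπF : (π : F) ≠ 0 := fun h => hπ0 (Subtype.ext h)
  have hP0 : ∀ x : K, x ≠ 0 → P.val (x : F) ≠ 0 := fun x hx =>
    (P.val.ne_zero_iff).2 fun h => hx (Subtype.ext h)
  have hlt : P.val (π : F) < 1 := by
    rw [h.val_lt_one_iff, hπ, ← WithZero.exp_zero, WithZero.exp_lt_exp]
    norm_num
  have hord : 0 ≤ P.ord (π : F) := by
    rw [← neg_zero, P.neg_le_ord_iff hπF]
    simpa using hlt.le
  refine ⟨(P.ord (π : F)).toNat, fun x => ?_⟩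
  rw [Int.toNat_of_nonneg hord]
  by_cases hx : x = 0
  · simp [hx, ord]
  have hQ0 := (Q.val.ne_zero_iff).2 hx
  set n := Q.ord x with hn
  have hQ1 : Q.val (x / π ^ n) = 1 := by
    rw [map_div₀, map_zpow₀, hπ, hn, ord, ← WithZero.exp_zsmul, smul_neg, smul_eq_mul, mul_one,
      neg_neg, WithZero.exp_log hQ0, div_self hQ0]
  have hP1 : P.val ((x / π ^ n : K) : F) = 1 :=
    le_antisymm ((h.val_le_one_iff _).2 hQ1.le)
      (not_lt.1 fun hlt => ((h.val_lt_one_iff _).1 hlt).ne hQ1)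
  have hx' : P.val (x : F) = P.val (π : F) ^ n := by
    have hcoe : ((π ^ n : K) : F) = (π : F) ^ n := map_zpow₀ (algebraMap K F) π n
    rwa [IntermediateField.coe_div, hcoe, map_div₀, map_zpow₀,
      div_eq_one_iff_eq (zpow_ne_zero _ (hP0 π hπ0))] at hP1
  rw [ord, ord, hx', WithZero.log_zpow, smul_eq_mul]
  ring

theorem LiesOver.ord_eq (h : P.LiesOver Q) (x : K) :
    P.ord x = P.ramificationIndex Q * Q.ord x :=
  Nat.sInf_mem (s := {e : ℕ | ∀ x : K, P.ord (x : F) = e * Q.ord x}) h.exists_ord_eq x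

end LiesOver

theorem conormCoeff_eq {K : IntermediateField k F} {P : Place k F} {Q : Place k K}
    (h : P.LiesOver Q) (A : Divisor k K) :
    Divisor.conormCoeff A P = P.ramificationIndex Q * A Q := by
  classical
  rw [Divisor.conormCoeff, Finsupp.sum, Finset.sum_eq_single Q]
  · rw [if_pos h]
  · intro Q' _ hQ'
    rw [if_neg fun h' => hQ' (h'.eq h)]
  · intro hQ
    rw [Finsupp.notMem_support_iff.1 hQ]
    simp

theorem conormCoeff_nonneg {K : IntermediateField k F} [Algebra.IsAlgebraic K F] {A : Divisor k K}
    (hA : 0 ≤ A) (P : Place k F) : 0 ≤ Divisor.conormCoeff A P := by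
  rw [conormCoeff_eq (P.liesOver_restrict K)]
  exact mul_nonneg (Nat.cast_nonneg _) (hA _)

theorem val_le_exp_conormCoeff {K : IntermediateField k F} [Algebra.IsAlgebraic K F]
    {A : Divisor k K} {x : K} (hx : x ∈ riemannRochSpace A) (P : Place k F) :
    P.val (x : F) ≤ WithZero.exp (Divisor.conormCoeff A P) := by
  by_cases hx0 : x = 0
  · simp [hx0]
  have h := P.liesOver_restrict K
  have hxF : (x : F) ≠ 0 := fun h => hx0 (Subtype.ext h)
  rw [← P.neg_le_ord_iff hxF, h.ord_eq, conormCoeff_eq h, ← mul_neg]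
  refine mul_le_mul_of_nonneg_left ?_ (Nat.cast_nonneg _)
  rw [Place.neg_le_ord_iff _ hx0]
  exact (mem_riemannRochSpace_iff _ _).1 hx _

/-! ### The action of automorphisms -/

/-- The place `σ(P)`. -/
def map (σ : F ≃ₐ[k] F) (P : Place k F) : Place k F where
  ring := P.ring.comap (σ.symm : F →+* F)
  const_mem a := by
    rw [ValuationSubring.mem_comap]
    simpa using P.const_mem a
  discrete := P.isDiscreteValuationRing_comap _ <| by
    obtain ⟨z, -, hz⟩ := P.exists_val_eq 1
    refine ⟨σ z, ?_⟩
    rw [← P.val_le_one_iff, RingHom.coe_coe, σ.symm_apply_apply, hz, ← WithZero.exp_zero,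
      WithZero.exp_le_exp]
    norm_num

theorem val_map_le_one_iff (σ : F ≃ₐ[k] F) (P : Place k F) (z : F) :
    (P.map σ).val z ≤ 1 ↔ P.val (σ.symm z) ≤ 1 := by
  rw [val_le_one_iff, val_le_one_iff]
  rfl

theorem val_map_lt_one_iff (σ : F ≃ₐ[k] F) (P : Place k F) (z : F) :
    (P.map σ).val z < 1 ↔ P.val (σ.symm z) < 1 := by
  rw [val_lt_one_iff_inv, val_lt_one_iff_inv, val_map_le_one_iff]
  simp

theorem map_mul (σ τ : F ≃ₐ[k] F) (P : Place k F) : P.map (σ * τ) = (P.map τ).map σ := rfl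

theorem map_one (P : Place k F) : P.map 1 = P := rfl

theorem map_inv_map (σ : F ≃ₐ[k] F) (P : Place k F) : (P.map σ).map σ⁻¹ = P := by
  rw [← map_mul, inv_mul_cancel, map_one]

theorem mem_orbit_iff (H : Subgroup (F ≃ₐ[k] F)) (P P' : Place k F) :
    P' ∈ orbit H P ↔ ∃ σ ∈ H, P' = P.map σ := by
  refine exists_congr fun σ => and_congr_right fun _ => ⟨fun h => ?_, ?_⟩
  · ext z
    rw [← σ.apply_symm_apply z, h]
    change _ ↔ σ.symm (σ (σ.symm z)) ∈ P.ring
    simp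
  · rintro rfl z
    change σ.symm (σ z) ∈ P.ring ↔ _
    simp

theorem LiesOver.map {G : Subgroup (F ≃ₐ[k] F)} {P : Place k F}
    {Q : Place k (IntermediateField.fixedField G)} (h : P.LiesOver Q) {σ : F ≃ₐ[k] F}
    (hσ : σ ∈ G) : (P.map σ).LiesOver Q := by
  rw [LiesOver, h]
  ext x
  have hx : σ.symm (x : F) = x := by
    rw [AlgEquiv.symm_apply_eq]
    exact ((IntermediateField.mem_fixedField_iff G _).1 x.2 σ hσ).symm
  change (x : F) ∈ P.ring ↔ σ.symm (x : F) ∈ P.ring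
  rw [hx]

end Place

/-! ### Rational places -/

namespace Place

theorem isRational_iff (P : Place k F) :
    P.IsRational ↔ ∀ z, P.val z ≤ 1 → ∃ a : k, P.val (z - algebraMap k F a) < 1 := by
  have key : ∀ (z : P.ring) (a : k), a • (1 : IsLocalRing.ResidueField P.ring) =
      IsLocalRing.residue P.ring z ↔ P.val ((z : F) - algebraMap k F a) < 1 := by
    intro z a
    have h1 : a • (1 : IsLocalRing.ResidueField P.ring) = P.residueₗ (a • 1) := by
      rw [map_smul]
      simp
    rw [h1, eq_comm, ← P.coe_residueₗ, ← sub_eq_zero, ← map_sub, P.coe_residueₗ,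
      P.residue_eq_zero_iff, ← P.coe_subtypeₗ, map_sub, map_smul, P.coe_subtypeₗ, P.coe_subtypeₗ,
      Algebra.smul_def]
    simp
  rw [IsRational, degree, finrank_eq_one_iff_of_nonzero' _ one_ne_zero]
  constructor
  · intro h z hz
    obtain ⟨a, ha⟩ := h (IsLocalRing.residue P.ring ⟨z, (P.val_le_one_iff z).1 hz⟩)
    exact ⟨a, (key _ _).1 ha⟩
  · intro h w
    obtain ⟨z, rfl⟩ := IsLocalRing.residue_surjective w
    obtain ⟨a, ha⟩ := h z ((P.val_le_one_iff _).2 z.2)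
    exact ⟨a, (key _ _).2 ha⟩

/-- Multiply `z` by a high power of a function congruent to `1` at `P` and to `0` at the rest of
`S`. -/
theorem exists_val_sub_lt_one (P : Place k F) (S : Finset (Place k F)) {z : F}
    (hz : P.val z ≤ 1) : ∃ z' : F, P.val (z' - z) < 1 ∧ ∀ Q ∈ S, Q ≠ P → Q.val z' < 1 := by
  classical
  obtain ⟨u, hu, huS⟩ := P.exists_val_sub_one_lt_one S
  have hM : ∀ Q : Place k F, ∃ M : ℕ, Q ∈ S → Q ≠ P → ∀ m ≥ M, Q.val (z * u ^ m) < 1 := by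
    intro Q
    by_cases hQ : Q ∈ S ∧ Q ≠ P
    · have hlt := huS Q hQ.1 hQ.2
      by_cases hz0 : Q.val z = 0
      · exact ⟨0, fun _ _ m _ => by rw [_root_.map_mul, hz0, zero_mul]; exact zero_lt_one⟩
      · obtain ⟨M, hM⟩ := exists_pow_lt₀ hlt (Units.mk0 (Q.val z)⁻¹ (inv_ne_zero hz0))
        refine ⟨M, fun _ _ m hm => ?_⟩
        have h1 : Q.val u ^ m < (Q.val z)⁻¹ := (pow_le_pow_of_le_one zero_le hlt.le hm).trans_lt hM
        rw [_root_.map_mul, map_pow]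
        calc Q.val z * Q.val u ^ m < Q.val z * (Q.val z)⁻¹ :=
              (mul_lt_mul_iff_right₀ (zero_lt_iff.2 hz0)).2 h1
          _ = 1 := mul_inv_cancel₀ hz0
    · exact ⟨0, fun h1 h2 => absurd ⟨h1, h2⟩ hQ⟩
  choose M hM using hM
  refine ⟨z * u ^ S.sup M, ?_, fun Q hQ hQP => hM Q hQ hQP _ (Finset.le_sup hQ)⟩
  have : z * u ^ S.sup M - z = z * ((u - 1) * ∑ i ∈ Finset.range (S.sup M), u ^ i) := by
    rw [mul_geom_sum]
    ring
  rw [this, _root_.map_mul, _root_.map_mul]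
  refine mul_lt_one_of_nonneg_of_lt_one_right hz zero_le
    (mul_lt_one_of_lt_of_le hu (P.val.map_sum_le fun i _ => ?_))
  rw [map_pow, P.val_eq_one_of_val_sub_one_lt_one hu, one_pow]

theorem le_val_of_val_sub_lt_one (P : Place k F) {x y : F} (hx : 1 ≤ P.val x)
    (h : P.val (y - x) < 1) : 1 ≤ P.val y := by
  by_contra! hy
  have := P.val.map_sub_lt hy h
  rw [sub_sub_cancel] at this
  exact absurd this (not_lt.2 hx)

section SplitsCompletely

variable {E : IntermediateField k F} {Q : Place k E}

/-- Dividing by an entry of largest value makes all entries integral and one of them equal to `1`;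
rationality of `Q` turns residues into constants. -/
theorem exists_mul_sub_lt_one (hQ : Q.IsRational) {ι : Type*} [Finite ι] (e : ι → E)
    (he : e ≠ 0) : ∃ s : E, s ≠ 0 ∧ ∃ c : ι → k, c ≠ 0 ∧
      ∀ a, Q.val (s * e a - algebraMap k E (c a)) < 1 := by
  obtain ⟨a₀, ha₀⟩ := Function.ne_iff.1 he
  have : Nonempty ι := ⟨a₀⟩
  obtain ⟨b, hb⟩ := Finite.exists_max fun a => Q.val (e a)
  have hpos : 0 < Q.val (e b) :=
    (zero_lt_iff.2 ((Q.val.ne_zero_iff).2 ha₀)).trans_le (hb a₀)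
  have hb0 : e b ≠ 0 := (Q.val.ne_zero_iff).1 hpos.ne'
  have hle : ∀ a, Q.val ((e b)⁻¹ * e a) ≤ 1 := fun a => by
    rw [_root_.map_mul, map_inv₀, mul_comm, ← div_eq_mul_inv]
    exact (div_le_one₀ hpos).2 (hb a)
  choose c hc using fun a => Q.isRational_iff.1 hQ _ (hle a)
  refine ⟨(e b)⁻¹, inv_ne_zero hb0, c, fun h => ?_, hc⟩
  have := hc b
  rw [h, inv_mul_cancel₀ hb0] at this
  simp at this

theorem SplitsCompletely.finite (hQ : Q.SplitsCompletely) :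
    {P : Place k F | P.LiesOver Q}.Finite := by
  have := hQ.1
  refine Set.finite_of_ncard_pos ?_
  rw [hQ.2]
  exact Module.finrank_pos

/-- A residue at `P` outside `k`, lifted to a function `z'` vanishing at the other places over `Q`,
could be joined to the separating functions to give `[F : E] + 1` elements independent over `E`. -/
theorem SplitsCompletely.isRational (hQ : Q.SplitsCompletely) (hrat : Q.IsRational)
    {P : Place k F} (hP : P.LiesOver Q) : P.IsRational := by
  classical
  rw [isRational_iff]
  by_contra! h
  obtain ⟨z, hz, hza⟩ := h
  have hfd := hQ.1
  let S := hQ.finite.toFinset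
  have hS : ∀ {R}, R ∈ S ↔ R.LiesOver Q := by simp [S]
  obtain ⟨u, hu, hu'⟩ := exists_separating S
  obtain ⟨z', hz', hz'S⟩ := P.exists_val_sub_lt_one S hz
  have hz'1 : P.val z' ≤ 1 := by
    have := P.val.map_add_le hz'.le hz
    rwa [sub_add_cancel] at this
  let w : Option S → F := fun o => o.elim z' u
  have hw1 : ∀ R : S, ∀ o, R.1.val (w o) ≤ 1 := by
    rintro R (_ | a)
    · by_cases hR : R.1 = P
      · rw [hR]
        exact hz'1
      · exact (hz'S R R.2 hR).le
    · exact val_separating_le_one hu hu' a R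
  have hli : LinearIndependent E w := by
    refine linearIndependent_of_reduction (k := k) w (S : Set (Place k F)) (fun e he => ?_)
      fun c hc => ?_
    · obtain ⟨s, hs, c, hc, hsc⟩ := exists_mul_sub_lt_one hrat e he
      exact ⟨s, hs, c, hc, fun R hR a => (hS.1 hR).val_lt_one_iff _ |>.2 (hsc a)⟩
    -- A nonzero coefficient at some `R ≠ P` is detected at `R`, where `z'` vanishes. Otherwise the
    -- combination is tested at `P`, where `z` is congruent to no constant.
    · by_cases hex : ∃ R : S, R.1 ≠ P ∧ c (some R) ≠ 0
      · obtain ⟨R, hRP, hR⟩ := hex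
        refine ⟨R, R.2, hw1 R, ?_⟩
        refine R.1.le_val_of_val_sub_lt_one (one_le_val_sum hu hu' (fun a => c (some a)) R hR) ?_
        rw [Fintype.sum_option, add_sub_assoc]
        simp only [w, Option.elim_none, Option.elim_some, sub_self, add_zero]
        exact (R.1.val_smul_le _ _).trans_lt (hz'S R R.2 hRP)
      · push Not at hex
        have hPS : P ∈ S := hS.2 hP
        refine ⟨P, hPS, hw1 ⟨P, hPS⟩, ?_⟩
        have hsum : ∑ o, c o • w o = c none • z' + c (some ⟨P, hPS⟩) • u ⟨P, hPS⟩ := by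
          rw [Fintype.sum_option, Finset.sum_eq_single ⟨P, hPS⟩]
          · rfl
          · intro R _ hR
            rw [hex R fun h => hR (Subtype.ext h), zero_smul]
          · simp
        rw [hsum]
        refine P.le_val_of_val_sub_lt_one
          (x := c none • z + algebraMap k F (c (some ⟨P, hPS⟩))) ?_ ?_
        · by_cases h0 : c none = 0
          · rw [h0, zero_smul, zero_add, P.val_algebraMap]
            intro h1
            refine hc (funext fun o => ?_)
            rcases o with _ | R
            · exact h0
            · by_cases hR : R.1 = P
              · have : R = ⟨P, hPS⟩ := Subtype.ext hR
                rw [this]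
                exact h1
              · exact hex R hR
          · have := hza (-(c (some ⟨P, hPS⟩) / c none))
            have heq : c none • z + algebraMap k F (c (some ⟨P, hPS⟩)) = algebraMap k F (c none) *
                (z - algebraMap k F (-(c (some ⟨P, hPS⟩) / c none))) := by
              rw [map_neg, map_div₀, Algebra.smul_def]
              have : algebraMap k F (c none) ≠ 0 := by simpa using h0
              field_simp
              ring
            rw [heq, _root_.map_mul, P.val_algebraMap h0, one_mul]
            exact this
        · have heq : c none • z' + c (some ⟨P, hPS⟩) • u ⟨P, hPS⟩ -
              (c none • z + algebraMap k F (c (some ⟨P, hPS⟩))) =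
              c none • (z' - z) + c (some ⟨P, hPS⟩) • (u ⟨P, hPS⟩ - 1) := by
            simp only [Algebra.smul_def]
            ring
          rw [heq]
          exact P.val.map_add_lt ((P.val_smul_le _ _).trans_lt hz')
            ((P.val_smul_le _ _).trans_lt (hu ⟨P, hPS⟩))
  have := hli.fintype_card_le_finrank
  rw [Fintype.card_option, Fintype.card_coe, ← hQ.2,
    Set.ncard_eq_toFinset_card _ hQ.finite] at this
  simp [S] at this

end SplitsCompletely

/-! ### Galois action on the places over a given place -/

theorem exists_approx_one_zero (S T : Finset (Place k F)) (h : Disjoint S T) :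
    ∃ z : F, (∀ P ∈ S, P.val (z - 1) < 1) ∧ ∀ P ∈ T, P.val z < 1 := by
  classical
  choose u hu hu' using fun P : Place k F => P.exists_val_sub_one_lt_one (S ∪ T)
  refine ⟨∑ P ∈ S, u P, fun P hP => ?_, fun P hP => ?_⟩
  · rw [← Finset.add_sum_erase S u hP, add_sub_right_comm]
    refine P.val.map_add_lt (hu P) (P.val.map_sum_lt one_ne_zero fun R hR => ?_)
    exact hu' R P (Finset.mem_union_left _ hP) (Finset.ne_of_mem_erase hR).symm
  · refine P.val.map_sum_lt one_ne_zero fun R hR => ?_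
    refine hu' R P (Finset.mem_union_right _ hP) ?_
    rintro rfl
    exact Finset.disjoint_left.1 h hR hP

/-- Were the two orbits disjoint, a function congruent to `1` on one and to `0` on the other would
have a norm in the fixed field that is a unit at `P` and vanishes at `P'`, although both lie over
`Q`. -/
theorem exists_map_eq {G : Subgroup (F ≃ₐ[k] F)} [Finite G]
    {Q : Place k (IntermediateField.fixedField G)} {P P' : Place k F} (hP : P.LiesOver Q)
    (hP' : P'.LiesOver Q) : ∃ σ ∈ G, P.map σ = P' := by
  classical
  have := Fintype.ofFinite G
  by_contra! hne
  obtain ⟨u, hu1, hu0⟩ := exists_approx_one_zero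
    (Finset.univ.image fun σ : G => P.map σ) (Finset.univ.image fun σ : G => P'.map σ) (by
      rw [Finset.disjoint_left]
      rintro _ h1 h2
      obtain ⟨σ, -, rfl⟩ := Finset.mem_image.1 h1
      obtain ⟨τ, -, h⟩ := Finset.mem_image.1 h2
      refine hne (τ⁻¹ * σ : G) (τ⁻¹ * σ : G).2 ?_
      rw [Subgroup.coe_mul, map_mul, ← h]
      exact map_inv_map _ _)
  let N : F := ∏ σ : G, (σ : F ≃ₐ[k] F) u
  have hN : N ∈ IntermediateField.fixedField G := by
    rw [IntermediateField.mem_fixedField_iff]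
    intro τ hτ
    rw [map_prod]
    exact Fintype.prod_equiv (Equiv.mulLeft ⟨τ, hτ⟩) _ _ fun σ => rfl
  have h1 : P.val N = 1 := by
    rw [map_prod]
    refine Finset.prod_eq_one fun σ _ => P.val_eq_one_of_val_sub_one_lt_one ?_
    have := hu1 (P.map (σ⁻¹ : G)) (Finset.mem_image_of_mem _ (Finset.mem_univ _))
    rw [val_map_lt_one_iff] at this
    change P.val ((σ : F ≃ₐ[k] F) (u - 1)) < 1 at this
    rwa [map_sub, _root_.map_one] at this
  have hlt : ∀ σ : G, P'.val ((σ : F ≃ₐ[k] F) u) < 1 := fun σ => by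
    have := hu0 (P'.map (σ⁻¹ : G)) (Finset.mem_image_of_mem _ (Finset.mem_univ _))
    rw [val_map_lt_one_iff] at this
    exact this
  have h2 : P'.val N < 1 := by
    rw [map_prod, ← Finset.mul_prod_erase _ _ (Finset.mem_univ 1)]
    exact mul_lt_one_of_lt_of_le (hlt 1) (Finset.prod_le_one' fun σ _ => (hlt σ).le)
  have h3 := (hP.val_lt_one_iff ⟨N, hN⟩).2 ((hP'.val_lt_one_iff ⟨N, hN⟩).1 h2)
  exact h3.ne h1

theorem finrank_fixedField (G : Subgroup (F ≃ₐ[k] F)) [Finite G] :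
    Module.finrank (IntermediateField.fixedField G) F = Nat.card G := by
  have := Fintype.ofFinite G
  rw [Nat.card_eq_fintype_card]
  exact FixedPoints.finrank_eq_card G F

theorem finiteDimensional_fixedField (G : Subgroup (F ≃ₐ[k] F)) [Finite G] :
    FiniteDimensional (IntermediateField.fixedField G) F := by
  have := Fintype.ofFinite G
  exact inferInstanceAs (FiniteDimensional (FixedPoints.subfield G F) F)

/-- The orbit map from `G` onto the places over `Q` is surjective between finite sets of equal size
`|G| = [F : E]`. -/
theorem SplitsCompletely.map_injOn {G : Subgroup (F ≃ₐ[k] F)} [Finite G]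
    {Q : Place k (IntermediateField.fixedField G)} (hQ : Q.SplitsCompletely) {P : Place k F}
    (hP : P.LiesOver Q) : Set.InjOn (fun σ => P.map σ) (G : Set (F ≃ₐ[k] F)) := by
  let φ : G → {P : Place k F | P.LiesOver Q} := fun σ => ⟨P.map σ, hP.map σ.2⟩
  have hφ : Function.Surjective φ := by
    rintro ⟨P', hP'⟩
    obtain ⟨σ, hσ, h⟩ := exists_map_eq hP hP'
    exact ⟨⟨σ, hσ⟩, Subtype.ext h⟩
  have hb := hφ.bijective_of_nat_card_le (by
    rw [Nat.card_coe_set_eq, hQ.2, finrank_fixedField])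
  intro σ hσ τ hτ h
  exact congrArg Subtype.val (hb.1 (a₁ := ⟨σ, hσ⟩) (a₂ := ⟨τ, hτ⟩) (Subtype.ext h))

end Place

/-! ### Order of a semidirect product -/

namespace IsSemidirectProduct

variable {A : Type*} [Group A] {G H₁ H₂ : Subgroup A}

theorem bijective_mul (h : IsSemidirectProduct G H₁ H₂) :
    Function.Bijective fun x : H₁ × H₂ =>
      (⟨x.1 * x.2, mul_mem (h.le_left x.1.2) (h.le_right x.2.2)⟩ : G) := by
  constructor
  · rintro ⟨a, b⟩ ⟨a', b'⟩ hab
    have hab' : (a : A) * b = a' * b' := congrArg Subtype.val hab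
    have h1 : (a' : A)⁻¹ * a = b' * (b : A)⁻¹ := by
      rw [inv_mul_eq_iff_eq_mul, ← mul_assoc, ← hab', mul_inv_cancel_right]
    have h2 : (a' : A)⁻¹ * a ∈ H₁ ⊓ H₂ :=
      Subgroup.mem_inf.2 ⟨mul_mem (inv_mem a'.2) a.2, h1 ▸ mul_mem b'.2 (inv_mem b.2)⟩
    rw [h.inf_eq, Subgroup.mem_bot] at h2
    have ha : a = a' := Subtype.ext (inv_mul_eq_one.1 h2).symm
    subst ha
    exact Prod.ext rfl (Subtype.ext (mul_left_cancel hab'))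
  · rintro ⟨g, hg⟩
    obtain ⟨a, ha, b, hb, rfl⟩ := h.exists_mul g hg
    exact ⟨⟨⟨a, ha⟩, ⟨b, hb⟩⟩, rfl⟩

theorem card_eq (h : IsSemidirectProduct G H₁ H₂) :
    Nat.card G = Nat.card H₁ * Nat.card H₂ := by
  rw [← Nat.card_prod, Nat.card_eq_of_bijective _ h.bijective_mul]

theorem finite [Finite H₁] [Finite H₂] (h : IsSemidirectProduct G H₁ H₂) : Finite G :=
  Finite.of_surjective _ h.bijective_mul.2

end IsSemidirectProduct

namespace Place

/-! ### Values of functions -/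

theorem hasValue_iff (P : Place k F) (z : F) (a : k) :
    P.HasValue z a ↔ P.val (z - algebraMap k F a) < 1 :=
  (P.val_lt_one_iff _).symm

theorem hasValue_zero_iff (P : Place k F) (z : F) : P.HasValue z 0 ↔ P.val z < 1 := by
  rw [hasValue_iff, _root_.map_zero, sub_zero]

theorem HasValue.sub {P : Place k F} {x y : F} {a b : k} (hx : P.HasValue x a)
    (hy : P.HasValue y b) : P.HasValue (x - y) (a - b) := by
  rw [hasValue_iff] at *
  have : x - y - algebraMap k F (a - b) = (x - algebraMap k F a) - (y - algebraMap k F b) := by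
    rw [map_sub]
    ring
  rw [this]
  exact P.val.map_sub_lt hx hy

theorem HasValue.add {P : Place k F} {x y : F} {a b : k} (hx : P.HasValue x a)
    (hy : P.HasValue y b) : P.HasValue (x + y) (a + b) := by
  rw [hasValue_iff] at *
  have : x + y - algebraMap k F (a + b) = (x - algebraMap k F a) + (y - algebraMap k F b) := by
    rw [map_add]
    ring
  rw [this]
  exact P.val.map_add_lt hx hy

theorem hasValue_algebraMap (P : Place k F) (a : k) : P.HasValue (algebraMap k F a) a := by
  rw [hasValue_iff, sub_self, _root_.map_zero]
  exact zero_lt_one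

theorem HasValue.val_le_one {P : Place k F} {x : F} {a : k} (hx : P.HasValue x a) :
    P.val x ≤ 1 := by
  rw [hasValue_iff] at hx
  have := P.val.map_add_le hx.le (P.val_algebraMap_le_one a)
  rwa [sub_add_cancel] at this

theorem HasValue.mul {P : Place k F} {x y : F} {a b : k} (hx : P.HasValue x a)
    (hy : P.HasValue y b) : P.HasValue (x * y) (a * b) := by
  have hy' := hy.val_le_one
  rw [hasValue_iff] at *
  have : x * y - algebraMap k F (a * b) =
      (x - algebraMap k F a) * y + algebraMap k F a * (y - algebraMap k F b) := by
    rw [_root_.map_mul]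
    ring
  rw [this]
  refine P.val.map_add_lt ?_ ?_ <;> rw [_root_.map_mul]
  · exact mul_lt_one_of_lt_of_le hx hy'
  · exact mul_lt_one_of_nonneg_of_lt_one_right (P.val_algebraMap_le_one a) zero_le hy

theorem HasValue.smul {P : Place k F} {x : F} {a : k} (c : k) (hx : P.HasValue x a) :
    P.HasValue (c • x) (c * a) := by
  rw [Algebra.smul_def]
  exact (P.hasValue_algebraMap c).mul hx

theorem HasValue.pow {P : Place k F} {x : F} {a : k} (hx : P.HasValue x a) (n : ℕ) :
    P.HasValue (x ^ n) (a ^ n) := by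
  induction n with
  | zero => simpa using P.hasValue_algebraMap 1
  | succ n ih => simpa only [pow_succ] using ih.mul hx

theorem HasValue.sum {P : Place k F} {ι : Type*} (s : Finset ι) {x : ι → F} {a : ι → k}
    (hx : ∀ i, P.HasValue (x i) (a i)) : P.HasValue (∑ i ∈ s, x i) (∑ i ∈ s, a i) := by
  classical
  induction s using Finset.induction_on with
  | empty => simpa using P.hasValue_algebraMap 0
  | insert i s hi ih =>
    rw [Finset.sum_insert hi, Finset.sum_insert hi]
    exact (hx i).add ih

theorem HasValue.unique {P : Place k F} {x : F} {a b : k} (ha : P.HasValue x a)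
    (hb : P.HasValue x b) : a = b := by
  have := ha.sub hb
  rw [sub_self, hasValue_iff, zero_sub, Valuation.map_neg, P.val_algebraMap_lt_one_iff] at this
  exact sub_eq_zero.1 this

theorem HasValue.hasValue_value {P : Place k F} {x : F} {a : k} (ha : P.HasValue x a) :
    P.HasValue x (P.value x) := by
  have h : ∃ a, P.HasValue x a := ⟨a, ha⟩
  rw [value, dif_pos h]
  exact h.choose_spec

theorem HasValue.value_eq {P : Place k F} {x : F} {a : k} (ha : P.HasValue x a) :
    P.value x = a :=
  ha.hasValue_value.unique ha

theorem HasValue.extValue_eq {P : Place k F} {x : F} {a : k} (ha : P.HasValue x a) :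
    P.extValue x = (a : OnePoint k) := by
  rw [extValue, if_pos ((P.val_le_one_iff _).1 ha.val_le_one), ha.value_eq]

theorem IsRational.exists_hasValue {P : Place k F} (hP : P.IsRational) {x : F}
    (hx : P.val x ≤ 1) : ∃ a, P.HasValue x a := by
  obtain ⟨a, ha⟩ := P.isRational_iff.1 hP x hx
  exact ⟨a, (P.hasValue_iff _ _).2 ha⟩

/-- Functions of the fixed field are constant along orbits; local recovery rests on this. -/
theorem hasValue_map_iff {H : Subgroup (F ≃ₐ[k] F)} (P : Place k F) {σ : F ≃ₐ[k] F} (hσ : σ ∈ H)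
    (x : IntermediateField.fixedField H) (a : k) :
    (P.map σ).HasValue (x : F) a ↔ P.HasValue (x : F) a := by
  have hx : σ.symm (x : F) = x := by
    rw [AlgEquiv.symm_apply_eq]
    exact ((IntermediateField.mem_fixedField_iff H _).1 x.2 σ hσ).symm
  rw [hasValue_iff, hasValue_iff, val_map_lt_one_iff, map_sub, hx, AlgEquiv.commutes]

theorem val_le_exp_poleOrder (P : Place k F) (z : F) : P.val z ≤ WithZero.exp (P.poleOrder z) := by
  by_cases hz : z = 0
  · simp [hz]
  rw [← P.neg_le_ord_iff hz, poleOrder]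
  have := le_max_right 0 (-P.ord z)
  linarith

theorem poleOrder_nonneg (P : Place k F) (z : F) : 0 ≤ P.poleOrder z := le_max_left _ _

end Place

/-! ### The function spaces `V_i` -/

section FunctionSpace

variable {K : IntermediateField k F} {A : Divisor k K} {w : F} {r : ℕ} {D : Divisor k F}

theorem exists_coeff_of_mem_functionSpace {m : ℕ}
    (f : Module.Basis (Fin m) k (riemannRochSpace A)) {z : F}
    (hz : z ∈ functionSpace (k := k) (fun j => ((f j : K) : F)) w r) :
    ∃ a : Fin r → K, (∀ l, a l ∈ riemannRochSpace A) ∧ z = ∑ l, (a l : F) * w ^ (l : ℕ) := by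
  obtain ⟨c, rfl⟩ := hz
  refine ⟨fun l => ((∑ j, c j l • f j : riemannRochSpace A) : K), fun l => SetLike.coe_mem _, ?_⟩
  refine Finset.sum_congr rfl fun l _ => ?_
  congr 1
  change _ = (K.val.toLinearMap ∘ₗ (riemannRochSpace A).subtype) (∑ j, c j l • f j)
  simp only [map_sum, map_smul]
  rfl

variable [Algebra.IsAlgebraic K F]

theorem sum_mem_riemannRochSpace
    (hD : ∀ P : Place k F, ((r : ℤ) - 1) * P.poleOrder w + Divisor.conormCoeff A P ≤ D P)
    {a : Fin r → K} (ha : ∀ l, a l ∈ riemannRochSpace A) :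
    ∑ l, (a l : F) * w ^ (l : ℕ) ∈ riemannRochSpace D := by
  refine Submodule.sum_mem _ fun l _ => ?_
  rw [Place.mem_riemannRochSpace_iff]
  intro P
  rw [map_mul, map_pow]
  calc P.val (a l : F) * P.val w ^ (l : ℕ)
      ≤ WithZero.exp (Divisor.conormCoeff A P) * WithZero.exp (P.poleOrder w) ^ (l : ℕ) :=
        mul_le_mul' (P.val_le_exp_conormCoeff (ha l))
          (pow_le_pow_left₀ zero_le (P.val_le_exp_poleOrder w) _)
    _ ≤ WithZero.exp (D P) := by
        rw [← WithZero.exp_nsmul, ← WithZero.exp_add, WithZero.exp_le_exp, nsmul_eq_mul]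
        -- The highest power of `w` is `r - 1`, which matches the multiple of the pole divisor
        -- allowed for in `D`.
        have h1 : ((l : ℕ) : ℤ) ≤ (r : ℤ) - 1 := by have := l.2; omega
        have h2 := mul_le_mul_of_nonneg_right h1 (P.poleOrder_nonneg w)
        linarith [hD P]

variable {P : Place k F}

theorem val_coeff_le_one (hr : 1 ≤ r)
    (hD : ∀ P : Place k F, ((r : ℤ) - 1) * P.poleOrder w + Divisor.conormCoeff A P ≤ D P)
    (hP : D P = 0) {x : K} (hx : x ∈ riemannRochSpace A) : P.val (x : F) ≤ 1 := by
  refine (P.val_le_exp_conormCoeff hx).trans ?_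
  rw [← WithZero.exp_zero, WithZero.exp_le_exp]
  have h1 := hD P
  have h2 : 0 ≤ ((r : ℤ) - 1) * P.poleOrder w :=
    mul_nonneg (by omega) (P.poleOrder_nonneg w)
  linarith

/-- For `r = 1` the factor `r - 1` vanishes and `w` may have a pole at `P`, whence the bound on `r`.
-/
theorem val_le_one_of_two_le (hr : 2 ≤ r) (hA : 0 ≤ A)
    (hD : ∀ P : Place k F, ((r : ℤ) - 1) * P.poleOrder w + Divisor.conormCoeff A P ≤ D P)
    (hP : D P = 0) : P.val w ≤ 1 := by
  refine (P.val_le_exp_poleOrder w).trans ?_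
  rw [← WithZero.exp_zero, WithZero.exp_le_exp]
  have h1 := hD P
  have h2 := Place.conormCoeff_nonneg hA P
  have h3 := P.poleOrder_nonneg w
  have h4 : (1 : ℤ) ≤ r - 1 := by omega
  nlinarith

end FunctionSpace

open Polynomial in
/-- A function of `V_i` that vanishes at all the other places of the `H_i`-orbit of a place
vanishes at that place too. -/
theorem hasValue_zero_of_orbit {H : Subgroup (F ≃ₐ[k] F)} [Finite H] {r : ℕ} (hr : 1 ≤ r)
    (hH : Nat.card H = r + 1) {A : Divisor k (IntermediateField.fixedField H)} (hA : 0 ≤ A)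
    {w : F} {D : Divisor k F}
    (hD : ∀ P : Place k F, ((r : ℤ) - 1) * P.poleOrder w + Divisor.conormCoeff A P ≤ D P)
    {P : Place k F} (hP : ∀ σ ∈ H, D (P.map σ) = 0 ∧ (P.map σ).IsRational)
    (hinj : Set.InjOn (fun σ => P.map σ) (H : Set (F ≃ₐ[k] F)))
    (hw : Set.InjOn (fun P' : Place k F => P'.extValue w) (Place.orbit H P))
    {a : Fin r → IntermediateField.fixedField H} (ha : ∀ l, a l ∈ riemannRochSpace A)
    (hz : ∀ σ ∈ H, σ ≠ 1 → (P.map σ).HasValue (∑ l, (a l : F) * w ^ (l : ℕ)) 0) :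
    P.HasValue (∑ l, (a l : F) * w ^ (l : ℕ)) 0 := by
  classical
  have := Fintype.ofFinite H
  have := Place.finiteDimensional_fixedField H
  have hP1 := hP 1 H.one_mem
  rw [Place.map_one] at hP1
  choose α hα using fun l => hP1.2.exists_hasValue (val_coeff_le_one hr hD hP1.1 (ha l))
  have hα' : ∀ σ ∈ H, ∀ l, (P.map σ).HasValue (a l : F) (α l) := fun σ hσ l =>
    (P.hasValue_map_iff hσ _ _).2 (hα l)
  -- For `r = 1` only the coefficient `a 0` occurs. It is constant on the orbit, so any `σ ≠ 1`
  -- suffices.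
  rcases hr.eq_or_lt with rfl | hr2
  · obtain ⟨σ, hσ⟩ : ∃ σ : H, σ ≠ 1 := by
      have : Nontrivial H := by
        rw [← Finite.one_lt_card_iff_nontrivial, hH]
        omega
      exact exists_ne 1
    have h1 := hz σ σ.2 fun h => hσ (Subtype.ext h)
    simp only [Fin.sum_univ_one, Fin.val_zero, pow_zero, mul_one] at h1 ⊢
    exact (P.hasValue_map_iff σ.2 _ _).1 h1
  · choose β hβ using fun σ : H =>
      (hP σ σ.2).2.exists_hasValue (val_le_one_of_two_le hr2 hA hD (hP σ σ.2).1)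
    have hβinj : Function.Injective β := by
      intro σ τ h
      have h1 : (P.map σ).extValue w = (P.map τ).extValue w := by
        rw [(hβ σ).extValue_eq, (hβ τ).extValue_eq, h]
      exact Subtype.ext (hinj σ.2 τ.2 (hw ((Place.mem_orbit_iff _ _ _).2 ⟨σ, σ.2, rfl⟩)
        ((Place.mem_orbit_iff _ _ _).2 ⟨τ, τ.2, rfl⟩) h1))
    let p : k[X] := ∑ l : Fin r, C (α l) * X ^ (l : ℕ)
    have hval : ∀ σ : H, (P.map σ).HasValue (∑ l, (a l : F) * w ^ (l : ℕ)) (p.eval (β σ)) := by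
      intro σ
      have : p.eval (β σ) = ∑ l, α l * β σ ^ (l : ℕ) := by simp [p, eval_finsetSum]
      rw [this]
      exact Place.HasValue.sum _ fun l => (hα' σ σ.2 l).mul ((hβ σ).pow l)
    -- The degree is less than `r`, and the `r` elements `σ ≠ 1` of `H` give distinct zeros.
    have hp : p = 0 := by
      refine eq_zero_of_degree_lt_of_eval_index_eq_zero (s := Finset.univ.erase (1 : H))
        (v := β) hβinj.injOn ?_ fun σ hσ => ?_
      · rw [Finset.card_erase_of_mem (Finset.mem_univ _), Finset.card_univ,
          ← Nat.card_eq_fintype_card, hH, Nat.add_sub_cancel]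
        exact degree_sum_fin_lt α
      · exact (hval σ).unique (hz σ σ.2 fun h => Finset.ne_of_mem_erase hσ (Subtype.ext h))
    have := hval 1
    rwa [hp, eval_zero, Subgroup.coe_one, Place.map_one] at this

end FunctionFieldCode

end

/-! ### The code and its parameters -/

open FunctionFieldCode in
theorem proposition3p1
    {k F : Type*} [Field k] [Finite k] [Field F] [Algebra k F] (hF : IsFunctionField k F)
    -- the subgroups `H₁ = H 0`, `H₂ = H 1` of orders `r₁ + 1`, `r₂ + 1`, and `G = H₁ ⋊ H₂`
    (r : Fin 2 → ℕ) (hr : ∀ i, 1 ≤ r i)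
    (H : Fin 2 → Subgroup (F ≃ₐ[k] F)) (hH : ∀ i, Nat.card (H i) = r i + 1)
    (G : Subgroup (F ≃ₐ[k] F)) (hG : IsSemidirectProduct G (H 0) (H 1))
    -- rational places `Q_1, …, Q_s` of `E = F^G` that split completely in `F`
    (s : ℕ) (Q : Fin s → Place k (IntermediateField.fixedField G)) (hQ : Function.Injective Q)
    (hQrat : ∀ i, (Q i).IsRational) (hQsplit : ∀ i, (Q i).SplitsCompletely)
    -- the evaluation places `P_1, …, P_n`: an enumeration of the places of `F` over the `Q_i`
    (n : ℕ) (P : Fin n → Place k F) (hP : Function.Injective P)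
    (hPQ : Set.range P = {P' | ∃ i, P'.LiesOver (Q i)})
    -- the functions `w₁`, `w₂`
    (w : Fin 2 → F)
    (hw_indep : ∀ i, LinearIndependent (IntermediateField.fixedField (H i))
      (fun l : Fin (r i) => w i ^ (l : ℕ)))
    (hw_eval : ∀ i j, Set.InjOn (fun P' : Place k F => P'.extValue (w i))
      (Place.orbit (H i) (P j)))
    -- the designed distance `d` and the divisor `D`
    (d : ℕ) (hd : 1 ≤ d) (hdn : d ≤ n)
    (D : Divisor k F) (hD : 0 ≤ D) (hDdeg : Divisor.degree D = (n : ℤ) - d)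
    (hDsupp : ∀ j, P j ∉ D.support)
    (hDw : ∀ i, ∀ P' : Place k F, ((r i : ℤ) - 1) * P'.poleOrder (w i) ≤ D P')
    -- the largest effective divisors `D₁`, `D₂` of `F₁`, `F₂` with
    -- `(r_i - 1) (w_i)_∞ + Conorm(D_i) ≤ D`
    (D' : ∀ i, Divisor k (IntermediateField.fixedField (H i)))
    (hD' : ∀ i, IsGreatest {A : Divisor k (IntermediateField.fixedField (H i)) | 0 ≤ A ∧
      ∀ P' : Place k F,
        ((r i : ℤ) - 1) * P'.poleOrder (w i) + Divisor.conormCoeff A P' ≤ D P'} (D' i))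
    -- bases of `L(D₁)`, `L(D₂)`
    (m : Fin 2 → ℕ) (f : ∀ i, Module.Basis (Fin (m i)) k (riemannRochSpace (D' i)))
    -- the spaces `V₁`, `V₂` and `V = V₁ ∩ V₂`
    (V₁ V₂ V : Submodule k F)
    (hV₁ : V₁ = functionSpace (fun j => ((f 0 j : IntermediateField.fixedField (H 0)) : F))
      (w 0) (r 0))
    (hV₂ : V₂ = functionSpace (fun j => ((f 1 j : IntermediateField.fixedField (H 1)) : F))
      (w 1) (r 1))
    (hV : V = V₁ ⊓ V₂) (hV0 : V ≠ ⊥) :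
    n = s * ((r 0 + 1) * (r 1 + 1)) ∧
    V₁ ≤ riemannRochSpace D ∧ V₂ ≤ riemannRochSpace D ∧
    (∀ j, (P j).IsRational ∧ ∀ g ∈ V, (P j).HasValue g (evaluation P g j)) ∧
    ∃ C : Submodule k (Fin n → k), (C : Set (Fin n → k)) = evaluation P '' (V : Set F) ∧
      IsLRC C (Module.finrank k V) d r := by
  classical
  have hHfin : ∀ i, Finite (H i) := fun i => Nat.finite_of_card_ne_zero (by rw [hH i]; omega)
  have hGfin : Finite G := hG.finite
  have hcardG : Nat.card G = (r 0 + 1) * (r 1 + 1) := by rw [hG.card_eq, hH, hH]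
  have hHG : ∀ i, H i ≤ G := Fin.forall_fin_two.2 ⟨hG.le_left, hG.le_right⟩
  have hKfin : ∀ i, FiniteDimensional (IntermediateField.fixedField (H i)) F :=
    fun i => Place.finiteDimensional_fixedField (H i)
  have hdisj : ∀ i i', i ≠ i' → ∀ σ ∈ H i, σ ∈ H i' → σ = 1 := by
    have h01 : ∀ σ ∈ H 0, σ ∈ H 1 → σ = 1 := fun σ h0 h1 =>
      Subgroup.mem_bot.1 (hG.inf_eq ▸ Subgroup.mem_inf.2 ⟨h0, h1⟩)
    simp only [Fin.forall_fin_two]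
    exact ⟨⟨fun h => absurd rfl h, fun _ => h01⟩, fun _ σ h1 h0 => h01 σ h0 h1,
      fun h => absurd rfl h⟩
  have hover : ∀ j, ∃ i, (P j).LiesOver (Q i) := fun j => by
    have : P j ∈ Set.range P := ⟨j, rfl⟩
    rwa [hPQ] at this
  have hmapP : ∀ j, ∀ σ ∈ G, ∃ j', P j' = (P j).map σ := fun j σ hσ => by
    obtain ⟨i, hi⟩ := hover j
    have : (P j).map σ ∈ Set.range P := by
      rw [hPQ]
      exact ⟨i, hi.map hσ⟩
    exact this
  have hinj : ∀ j, Set.InjOn (fun σ => (P j).map σ) (G : Set (F ≃ₐ[k] F)) := fun j => by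
    obtain ⟨i, hi⟩ := hover j
    exact (hQsplit i).map_injOn hi
  have hrat : ∀ j, (P j).IsRational := fun j => by
    obtain ⟨i, hi⟩ := hover j
    exact (hQsplit i).isRational (hQrat i) hi
  have hDP : ∀ j, D (P j) = 0 := fun j => Finsupp.notMem_support_iff.1 (hDsupp j)
  have hVle : ∀ i, functionSpace (fun j => ((f i j : IntermediateField.fixedField (H i)) : F))
      (w i) (r i) ≤ riemannRochSpace D := by
    intro i z hz
    obtain ⟨a, ha, rfl⟩ := exists_coeff_of_mem_functionSpace (f i) hz
    exact sum_mem_riemannRochSpace (hD' i).1.2 ha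
  have hVi : ∀ i, V ≤ functionSpace
      (fun j => ((f i j : IntermediateField.fixedField (H i)) : F)) (w i) (r i) := by
    rw [Fin.forall_fin_two, hV, ← hV₁, ← hV₂]
    exact ⟨inf_le_left, inf_le_right⟩
  have hVD : V ≤ riemannRochSpace D := (hVi 0).trans (hVle 0)
  have hval : ∀ g ∈ V, ∀ j, (P j).HasValue g (evaluation P g j) := fun g hg j => by
    have h1 := (Place.mem_riemannRochSpace_iff _ _).1 (hVD hg) (P j)
    rw [hDP, WithZero.exp_zero] at h1
    obtain ⟨a, ha⟩ := (hrat j).exists_hasValue h1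
    exact ha.hasValue_value
  have hsub : ∀ g ∈ V, ∀ g' ∈ V, ∀ j,
      evaluation P (g - g') j = evaluation P g j - evaluation P g' j := fun g hg g' hg' j =>
    (hval _ (V.sub_mem hg hg') j).unique ((hval g hg j).sub (hval g' hg' j))
  have hzeros : ∀ g ∈ V, g ≠ 0 →
      (Finset.univ.filter fun j => evaluation P g j = 0).card + d ≤ n := by
    intro g hg hg0
    have h1 := card_zeros_le_degree hF hD (hVD hg) hg0
      ((Finset.univ.filter fun j => evaluation P g j = 0).image P) (by
        intro P' hP'
        obtain ⟨j, hj, rfl⟩ := Finset.mem_image.1 hP'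
        rw [← Place.hasValue_zero_iff, ← (Finset.mem_filter.1 hj).2]
        exact hval g hg j)
    rw [Finset.card_image_of_injective _ hP, hDdeg] at h1
    omega
  -- Recovery in linear form: by passing to differences of codewords it is enough to treat the value
  -- zero.
  have hrec : ∀ i j, ∀ g ∈ V,
      (∀ j', (∃ σ ∈ H i, σ ≠ 1 ∧ P j' = (P j).map σ) → evaluation P g j' = 0) →
      evaluation P g j = 0 := by
    intro i j g hg h
    refine (hval g hg j).unique ?_
    obtain ⟨a, ha, hga⟩ := exists_coeff_of_mem_functionSpace (f i) (hVi i hg)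
    rw [hga]
    refine hasValue_zero_of_orbit (hr i) (hH i) (hD' i).1.1 (hD' i).1.2 (fun σ hσ => ?_)
      ((hinj j).mono (hHG i)) (hw_eval i j) ha fun σ hσ hσ1 => ?_
    · obtain ⟨j', hj'⟩ := hmapP j σ (hHG i hσ)
      rw [← hj']
      exact ⟨hDP j', hrat j'⟩
    · obtain ⟨j', hj'⟩ := hmapP j σ (hHG i hσ)
      rw [← hj', ← hga, ← h j' ⟨σ, hσ, hσ1, hj'⟩]
      exact hval g hg j'
  let φ : V →ₗ[k] (Fin n → k) :=
    { toFun := fun g => evaluation P g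
      map_add' := fun g g' => funext fun j =>
        (hval _ (g + g').2 j).unique ((hval _ g.2 j).add (hval _ g'.2 j))
      map_smul' := fun c g => funext fun j =>
        (hval _ (c • g).2 j).unique ((hval _ g.2 j).smul c) }
  have hφ : Function.Injective φ := by
    rw [injective_iff_map_eq_zero]
    intro g hg
    by_contra hg0
    have h1 := hzeros g g.2 fun h => hg0 (Subtype.ext h)
    -- All `n` coordinates vanish, so `hzeros` would give `n + d ≤ n`, against `d ≥ 1`.
    have h2 : ∀ j, evaluation P g j = 0 := congrFun hg
    rw [Finset.filter_true_of_mem fun j _ => h2 j, Finset.card_univ, Fintype.card_fin] at h1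
    omega
  have hrange : (LinearMap.range φ : Set (Fin n → k)) = evaluation P '' (V : Set F) := by
    ext x
    constructor
    · rintro ⟨g, rfl⟩
      exact ⟨g, g.2, rfl⟩
    · rintro ⟨g, hg, rfl⟩
      exact ⟨⟨g, hg⟩, rfl⟩
  refine ⟨?_, hV₁ ▸ hVle 0, hV₂ ▸ hVle 1, fun j => ⟨hrat j, fun g hg => hval g hg j⟩,
    LinearMap.range φ, hrange, ?_, ?_, ?_⟩
  -- The evaluation places are partitioned into the `s` fibres over the `Q i`, each with `[F : E] =
  -- |G|` elements.
  · have hunion : Finset.univ.image P =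
        Finset.univ.biUnion fun i => (hQsplit i).finite.toFinset := by
      ext P'
      have := Set.ext_iff.1 hPQ P'
      simpa using this
    have h1 := congrArg Finset.card hunion
    rw [Finset.card_image_of_injective _ hP, Finset.card_univ, Fintype.card_fin,
      Finset.card_biUnion] at h1
    · rw [h1, Finset.sum_congr rfl fun i _ => by
        rw [← Set.ncard_eq_toFinset_card _ (hQsplit i).finite, (hQsplit i).2,
          Place.finrank_fixedField, hcardG]]
      simp
    · intro i _ i' _ hii'
      rw [Function.onFun, Finset.disjoint_left]
      intro P' h h'
      have h1 : P'.LiesOver (Q i) := (hQsplit i).finite.mem_toFinset.1 h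
      have h2 : P'.LiesOver (Q i') := (hQsplit i').finite.mem_toFinset.1 h'
      exact hii' (hQ (h1.eq h2))
  · exact LinearMap.finrank_range_of_inj hφ
  · refine le_csInf ?_ ?_
    -- The infimum of an empty set of distances would be `0`, so two distinct codewords are
    -- exhibited.
    · obtain ⟨g, hg, hg0⟩ := V.exists_mem_ne_zero_of_ne_bot hV0
      exact ⟨_, φ ⟨g, hg⟩, ⟨_, rfl⟩, φ 0, ⟨_, rfl⟩,
        fun h => hg0 (congrArg Subtype.val (hφ h)), rfl⟩
    · rintro _ ⟨_, ⟨g, rfl⟩, _, ⟨g', rfl⟩, hne, rfl⟩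
      have hgg' : (g : F) - g' ≠ 0 := fun h => hne (by rw [Subtype.ext (sub_eq_zero.1 h)])
      have h1 := hzeros _ (V.sub_mem g.2 g'.2) hgg'
      have h2 := Finset.card_filter_add_card_filter_not (s := (Finset.univ : Finset (Fin n)))
        (fun j => evaluation P ((g : F) - g') j = 0)
      rw [Finset.card_univ, Fintype.card_fin] at h2
      have h3 : hammingDist (φ g) (φ g') = (Finset.univ.filter fun j =>
          ¬ evaluation P ((g : F) - g') j = 0).card := by
        rw [hammingDist]
        congr 1
        ext j
        simp only [Finset.mem_filter, Finset.mem_univ, true_and,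
          hsub _ g.2 _ g'.2, sub_eq_zero]
        rfl
      have h4 : d ≤ hammingDist (φ g) (φ g') := by omega
      convert h4
  · intro j
    refine ⟨fun i => Finset.univ.filter fun j' => ∃ σ ∈ H i, σ ≠ 1 ∧ P j' = (P j).map σ,
      fun i i' hii' => ?_, fun i => ⟨?_, ?_, fun a b hab => ?_⟩⟩
    -- A common place would be `σ(P_j) = τ(P_j)` with `σ`, `τ` in different factors; freeness gives
    -- `σ = τ`, which then lies in the trivial intersection.
    · rw [Finset.disjoint_left]
      intro j' h h'
      obtain ⟨σ, hσ, hσ1, e⟩ := (Finset.mem_filter.1 h).2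
      obtain ⟨τ, hτ, -, e'⟩ := (Finset.mem_filter.1 h').2
      have hστ : σ = τ := hinj j (hHG i hσ) (hHG i' hτ) (e.symm.trans e')
      exact hσ1 (hdisj i i' hii' σ hσ (hστ ▸ hτ))
    · rw [Finset.mem_filter]
      rintro ⟨-, σ, hσ, hσ1, e⟩
      exact hσ1 (hinj j (hHG i hσ) G.one_mem e.symm)
    · have := Fintype.ofFinite (H i)
      rw [← Finset.card_image_of_injective _ hP]
      refine (Finset.card_le_card (t := ((Finset.univ : Finset (H i)).erase 1).image
        fun σ : H i => (P j).map σ) fun P' hP' => ?_).trans (Finset.card_image_le.trans ?_)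
      · obtain ⟨j', hj', rfl⟩ := Finset.mem_image.1 hP'
        obtain ⟨σ, hσ, hσ1, e⟩ := (Finset.mem_filter.1 hj').2
        exact Finset.mem_image.2 ⟨⟨σ, hσ⟩, Finset.mem_erase.2
          ⟨fun h => hσ1 (congrArg Subtype.val h), Finset.mem_univ _⟩, e.symm⟩
      · rw [Finset.card_erase_of_mem (Finset.mem_univ _), Finset.card_univ,
          ← Nat.card_eq_fintype_card, hH, Nat.add_sub_cancel]
    · rw [Set.disjoint_left]
      rintro _ ⟨_, ⟨⟨g, rfl⟩, hga⟩, rfl⟩ ⟨_, ⟨⟨g', rfl⟩, hgb⟩, he⟩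
      apply hab
      -- Codewords that agree on the recovering set have a difference vanishing there, hence also at
      -- `j`.
      have h0 := hrec i j _ (V.sub_mem g.2 g'.2) fun j' hj' => by
        rw [hsub _ g.2 _ g'.2, sub_eq_zero]
        exact (congrFun he ⟨j', Finset.mem_filter.2 ⟨Finset.mem_univ _, hj'⟩⟩).symm
      rw [hsub _ g.2 _ g'.2, sub_eq_zero] at h0
      rw [← hga, ← hgb]
      exact h0
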